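/- **Setting.** All graphs have a finite node set $\mathbf V$. A MAG is a maximal ancestral graph with directed and bidirected edges; the PAG of a Markov equivalence class of MAGs has their common adjacencies, shows the tails and arrowheads common to all MAGs of the class, and has circles at all other ends of edges. Let $r\ge 0$. A PAG $\mathcal P^{(r)}$ on $\mathbf V$ is an $r$-PAG if, for some MAG $M$ on $\mathbf V$, it is the PAG of (the class of) a MAG $N$ such that two nodes are non-adjacent in $N$ exactly when some set of at most $r$ nodes m-separates them in $M$, and such that $N$ and $M$ have the same pairwise m-separations by sets of at most $r$ nodes. m-separation in a PAG means absence of a definite m-connecting path: a path each of whose non-endpoint nodes is either a collider that has a descendant in (or lies in) the conditioning set, or a definite non-collider (an edge of the path is directed out of it, or both edges of the path have a circle at it and its two neighbours on the path are non-adjacent) outside the conditioning set. For distinct non-adjacent $X,Y$, $\operatorname{MinSep}_{\mathcal P^{(r)}}(X,Y)$ is the set of all $\mathbf Z\subseteq\mathbf V\setminus\{X,Y\}$ that m-separate $X$ and $Y$ in $\mathcal P^{(r)}$ while no proper subset of $\mathbf Z$ does. Collider and non-collider triples with order (triples being read up to reversal, $\langle a,b,c\rangle=\langle c,b,a\rangle$;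 in a PAG, non-collider means definite non-collider) are defined recursively. Those of order $0$ are the unshielded colliders and the unshielded non-colliders. A collider (non-collider) $\langle a,b,c\rangle$ with $a \neq c$ that is not a collider (non-collider) triple of order $<i$ has order $i\ge 1$ if, for it or its reversal, there is a node $q$ such that $\langle q,a,b\rangle$ is a collider triple of order $<i$ and $\langle q,a,c\rangle$ is a non-collider triple of order $<i$. A triple $\langle A,B,C\rangle$ with order corresponds to a pair of distinct non-adjacent nodes $(X,Y)$ if $X=A$, $Y=C$ and the triple is unshielded, or if $\langle X,\dots,A,B,Y\rangle$ with $Y=C$, or $\langle Y,\dots,A,B,X\rangle$ with $X=C$, is a discriminating path for $B$ (a path with at least three edges and non-adjacent endpoints, on which every node strictly between the first endpoint and $B$ is a collider and a parent of the last endpoint). **Proposition.** Let $\mathcal P^{(r)}$ be an $r$-PAG and $\mathbf Z\in\operatorname{MinSep}_{\mathcal P^{(r)}}(X,Y)$. For every $Z_i\in\mathbf Z$ there exist nodes $(X',Y')$, possibly equal to $(X,Y)$, a set $\mathbf Z'\in\operatorname{MinSep}_{\mathcal P^{(r)}}(X',Y')$ with $Z_i\in\mathbf Z'$, and a node $A$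 such that $\langle A,Z_i,Y'\rangle$ is a non-collider triple with order in $\mathcal P^{(r)}$ corresponding to $(X',Y')$. (So either $A=X'$ and $\langle X',Z_i,Y'\rangle$ is unshielded, or $\langle X',\dots,A,Z_i,Y'\rangle$ is a discriminating path for $Z_i$.) -/

import Mathlib

/-- The three kinds of end points of an edge: tail, arrowhead and circle. -/
inductive EndMark : Type
  | tail
  | arrow
  | circle

/-- A mixed graph with at most one edge between two nodes and no loops. If `a` and `b` are adjacent,
`mark a b = some m` says that the edge between `a` and `b` carries the mark `m` at its end `b`
(and `mark b a` is then its mark at the end `a`); `mark a b = none` says that there is no edge. -/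
structure MixedGraph (V : Type*) where
  mark : V → V → Option EndMark
  mark_self : ∀ a, mark a a = none
  mark_none_symm : ∀ a b, mark a b = none → mark b a = none

namespace MixedGraph

variable {V : Type*}

/-- `a` and `b` are adjacent. -/
def Adj (G : MixedGraph V) (a b : V) : Prop := G.mark a b ≠ none

/-- The directed edge `a → b` is in `G` (`a` is a parent of `b`). -/
def Directed (G : MixedGraph V) (a b : V) : Prop :=
  G.mark b a = some EndMark.tail ∧ G.mark a b = some EndMark.arrow

/-- The bidirected edge `a ↔ b` is in `G` (`a` is a spouse of `b`). -/
def Bidirected (G : MixedGraph V) (a b : V) : Prop :=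
  G.mark b a = some EndMark.arrow ∧ G.mark a b = some EndMark.arrow

/-- `a` is an ancestor of `b`: there is a directed path, possibly of length zero, from `a` to `b`. -/
def Ancestor (G : MixedGraph V) (a b : V) : Prop := Relation.ReflTransGen G.Directed a b

/-- `a *→ b ←* c`. -/
def IsCollider (G : MixedGraph V) (a b c : V) : Prop :=
  G.mark a b = some EndMark.arrow ∧ G.mark c b = some EndMark.arrow

/-- `b` is a definite non-collider between its neighbours `a` and `c`: one of the two edges is
directed out of `b`, or both edges have a circle at `b` and `a`, `c` are not adjacent. -/
def IsDefNonCollider (G : MixedGraph V) (a b c : V) : Prop :=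
  G.Adj a b ∧ G.Adj b c ∧
    (G.Directed b a ∨ G.Directed b c ∨
      (G.mark a b = some EndMark.circle ∧ G.mark c b = some EndMark.circle ∧ ¬ G.Adj a c))

/-- `⟨a, b, c⟩` is an unshielded triple. -/
def IsUnshielded (G : MixedGraph V) (a b c : V) : Prop :=
  G.Adj a b ∧ G.Adj b c ∧ a ≠ c ∧ ¬ G.Adj a c

/-- `p` is a path (no repeated nodes, consecutive nodes adjacent) between `x` and `y`. -/
def IsPath (G : MixedGraph V) (p : List V) (x y : V) : Prop :=
  p.Nodup ∧ p.IsChain G.Adj ∧ p.head? = some x ∧ p.getLast? = some y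

/-- `a, b, c` are consecutive on the path `p`. -/
def Consecutive (p : List V) (a b c : V) : Prop := [a, b, c] <:+: p

/-! ### Maximal ancestral graphs -/

/-- `p` is an inducing path between `x` and `y`: every non-endpoint node is a collider on `p` and an
ancestor of `x` or of `y`. -/
def IsInducingPath (G : MixedGraph V) (p : List V) (x y : V) : Prop :=
  G.IsPath p x y ∧
    ∀ a b c, Consecutive p a b c → G.IsCollider a b c ∧ (G.Ancestor b x ∨ G.Ancestor b y)

/-- Maximal ancestral graphs, with directed and bidirected edges only. -/
structure IsMAG (G : MixedGraph V) : Prop where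
  edges : ∀ a b, G.Adj a b → G.Directed a b ∨ G.Directed b a ∨ G.Bidirected a b
  no_directed_cycle : ∀ a, ¬ Relation.TransGen G.Directed a a
  no_almost_directed_cycle : ∀ a b, G.Bidirected a b → ¬ G.Ancestor a b
  maximal : ∀ x y, x ≠ y → ¬ G.Adj x y → ¬ ∃ p, G.IsInducingPath p x y

/-- `p` is an m-connecting path of a MAG between `x` and `y` relative to `Z`. -/
def IsMConnecting (G : MixedGraph V) (p : List V) (x y : V) (Z : Finset V) : Prop :=
  G.IsPath p x y ∧ ∀ a b c, Consecutive p a b c →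
    (G.IsCollider a b c → ∃ z ∈ Z, G.Ancestor b z) ∧ (¬ G.IsCollider a b c → b ∉ Z)

/-- m-separation in a MAG of two sets of nodes by a third one (the three being disjoint). -/
def MSep (G : MixedGraph V) (X Y Z : Finset V) : Prop :=
  ∀ x ∈ X, ∀ y ∈ Y, ¬ ∃ p, G.IsMConnecting p x y Z

/-- Markov equivalence of MAGs. -/
def MarkovEquiv (M N : MixedGraph V) : Prop :=
  ∀ X Y Z : Finset V, Disjoint X Y → Disjoint X Z → Disjoint Y Z → (M.MSep X Y Z ↔ N.MSep X Y Z)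

/-! ### Partial ancestral graphs -/

/-- `P` is the PAG of the Markov equivalence class of the MAG `M`: it has the adjacencies of every
MAG of the class, a tail (an arrowhead) exactly where all MAGs of the class have a tail (an
arrowhead), and hence circles at all other ends of edges. -/
structure IsPAGOf (P M : MixedGraph V) : Prop where
  adj : ∀ N : MixedGraph V, N.IsMAG → MarkovEquiv M N → ∀ a b, P.Adj a b ↔ N.Adj a b
  tail : ∀ a b, P.mark a b = some EndMark.tail ↔
    ∀ N : MixedGraph V, N.IsMAG → MarkovEquiv M N → N.mark a b = some EndMark.tail
  arrow : ∀ a b, P.mark a b = some EndMark.arrow ↔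
    ∀ N : MixedGraph V, N.IsMAG → MarkovEquiv M N → N.mark a b = some EndMark.arrow

/-- `P` is the `r`-PAG of the MAG `M`: the PAG (of the class of some MAG `N`) that incorporates
exactly the conditional independencies of `M` given at most `r` variables. That is, two nodes are
non-adjacent if and only if they are m-separated in `M` by some set of size at most `r`, and the
m-separations by sets of size at most `r` are those of `M`. -/
def IsRPAGOf (r : ℕ) (P M : MixedGraph V) : Prop :=
  ∃ N : MixedGraph V, N.IsMAG ∧ P.IsPAGOf N ∧
    (∀ x y, x ≠ y →
      (¬ N.Adj x y ↔ ∃ Z : Finset V, x ∉ Z ∧ y ∉ Z ∧ Z.card ≤ r ∧ M.MSep {x} {y} Z)) ∧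
    (∀ x y, x ≠ y → ∀ Z : Finset V, x ∉ Z → y ∉ Z → Z.card ≤ r →
      (N.MSep {x} {y} Z ↔ M.MSep {x} {y} Z))

/-- `P` is an `r`-PAG on the node set `V`. -/
def IsRPAG (r : ℕ) (P : MixedGraph V) : Prop :=
  ∃ M : MixedGraph V, M.IsMAG ∧ IsRPAGOf r P M

/-- `p` is a definite m-connecting path of a PAG between `x` and `y` relative to `Z`: every
non-endpoint node is either a collider or a definite non-collider on `p` (`p` has definite status),
colliders are ancestors of elements of `Z` and definite non-colliders are outside `Z`. -/
def IsDefMConnecting (P : MixedGraph V) (p : List V) (x y : V) (Z : Finset V) : Prop :=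
  P.IsPath p x y ∧ ∀ a b c, Consecutive p a b c →
    (P.IsCollider a b c ∨ P.IsDefNonCollider a b c) ∧
    (P.IsCollider a b c → ∃ z ∈ Z, P.Ancestor b z) ∧
    (P.IsDefNonCollider a b c → b ∉ Z)

/-- m-separation of two nodes `x`, `y` by a set `Z` (not containing them) in a PAG. -/
def PAGMSep (P : MixedGraph V) (x y : V) (Z : Finset V) : Prop :=
  ¬ ∃ p, P.IsDefMConnecting p x y Z

/-- The set of minimal separators of the pair of distinct non-adjacent nodes `x`, `y` in a PAG
(empty if `x = y` or if `x` and `y` are adjacent). -/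
def MinSep (P : MixedGraph V) (x y : V) : Set (Finset V) :=
  {Z | x ≠ y ∧ ¬ P.Adj x y ∧ x ∉ Z ∧ y ∉ Z ∧ P.PAGMSep x y Z ∧ ∀ W, W ⊂ Z → ¬ P.PAGMSep x y W}

/-! ### Triples with order -/

mutual

/-- `⟨a, b, c⟩` is a collider triple with order `i`. Triples are read up to reversal: `⟨a, b, c⟩`
and `⟨c, b, a⟩` have the same order, whichever of `a`, `c` plays the role of the lower-order node. -/
def ColliderOfOrder (G : MixedGraph V) (i : ℕ) (a b c : V) : Prop :=
  (i = 0 ∧ G.IsUnshielded a b c ∧ G.IsCollider a b c) ∨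
  (1 ≤ i ∧ (∀ j : Fin i, ¬ ColliderOfOrder G j.1 a b c) ∧ a ≠ c ∧ G.IsCollider a b c ∧
    ((∃ q, (∃ j : Fin i, ColliderOfOrder G j.1 q a b) ∧
        (∃ k : Fin i, NonColliderOfOrder G k.1 q a c)) ∨
      (∃ q, (∃ j : Fin i, ColliderOfOrder G j.1 q c b) ∧
        (∃ k : Fin i, NonColliderOfOrder G k.1 q c a))))
termination_by i
decreasing_by all_goals exact Fin.is_lt _

/-- `⟨a, b, c⟩` is a non-collider triple with order `i` (again up to reversal). In a graph with
circles, non-colliders are definite non-colliders; in a MAG these are exactly the non-colliders. -/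
def NonColliderOfOrder (G : MixedGraph V) (i : ℕ) (a b c : V) : Prop :=
  (i = 0 ∧ G.IsUnshielded a b c ∧ G.IsDefNonCollider a b c) ∨
  (1 ≤ i ∧ (∀ j : Fin i, ¬ NonColliderOfOrder G j.1 a b c) ∧ a ≠ c ∧ G.IsDefNonCollider a b c ∧
    ((∃ q, (∃ j : Fin i, ColliderOfOrder G j.1 q a b) ∧
        (∃ k : Fin i, NonColliderOfOrder G k.1 q a c)) ∨
      (∃ q, (∃ j : Fin i, ColliderOfOrder G j.1 q c b) ∧
        (∃ k : Fin i, NonColliderOfOrder G k.1 q c a))))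
termination_by i
decreasing_by all_goals exact Fin.is_lt _

end

/-- `⟨a, b, c⟩` is a non-collider triple with order. -/
def NonColliderWithOrder (G : MixedGraph V) (a b c : V) : Prop :=
  ∃ i, G.NonColliderOfOrder i a b c

/-- `⟨x, l, a, b, y⟩` is a discriminating path for `b`: it is a path with at least three edges, `x`
and `y` are not adjacent, and every node strictly between `x` and `b` is a collider on the path and a
parent of `y`. -/
def IsDiscriminatingPath (G : MixedGraph V) (x : V) (l : List V) (a b y : V) : Prop :=
  G.IsPath (x :: (l ++ [a, b, y])) x y ∧ ¬ G.Adj x y ∧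
    ∀ v ∈ l ++ [a], G.Directed v y ∧
      ∀ u w, Consecutive (x :: (l ++ [a, b, y])) u v w → G.IsCollider u v w

/-- The triple `⟨a, b, c⟩` corresponds to the pair of non-adjacent nodes `x`, `y`. -/
def TripleCorresponds (G : MixedGraph V) (a b c x y : V) : Prop :=
  x ≠ y ∧ ¬ G.Adj x y ∧
    ((x = a ∧ y = c ∧ G.IsUnshielded a b c) ∨
      (y = c ∧ ∃ l, G.IsDiscriminatingPath x l a b y) ∨
      (x = c ∧ ∃ l, G.IsDiscriminatingPath y l a b x))

end MixedGraph

-- Fix a MAG `N` of the class and let W be Z without Zi. By minimality of Z some path of `P`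
-- m-connects X and Y given W, and it also connects them in `N`. Among the connecting paths of `N`
-- choose a shortest one and, among these, one whose nodes have least total distance to W. The point
-- is that this path is definite m-connecting given W in `P` as well. Zi is then a non-collider on
-- it, since otherwise the path would connect given Z.
--
-- Status of the triples. If `v t` and `v (t + 2)` are adjacent, skipping `v (t + 1)` must close the
-- path at one of them. Following the colliders away from that node gives a discriminating path for
-- `v (t + 1)` along `v` (`IsShortest.discriminated`). Every separator of the endpoints of a
-- discriminating path contains its inner nodes, and contains the discriminated node exactly when
-- that is a non-collider. Markov equivalent MAGs share separators, so `P` shows the status once it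
-- shows the inner colliders (`IsPAGOf.isDiscriminating`); the recursion for order has the same
-- shape (`IsDiscriminating.hasOrder`). Left and right discriminating paths could depend on each
-- other in a circle, but ancestrality and maximality forbid crossings (`IsTriplePath.not_cross`,
-- `forall_of_not_cross`). Hence `IsPAGOf.isSettled`.
--
-- Ancestors of W. Let d follow a collider on a shortest directed path to W. Either `P` shows the
-- edge to d, and then the whole directed path (`IsPAGOf.ancestor_of_directed`), or the connecting
-- path can be diverted to d from both sides, which yields a shorter or closer path
-- (`IsClosest.not_detour`).
--
-- Finally Zi ends a discriminating sequence of `P` as a definite non-collider, so it lies in every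
-- separator of the endpoints of that sequence, in particular in a minimal one.

namespace MixedGraph

variable {V : Type*}

-- Edge marks and the status of triples

lemma Adj.symm {G : MixedGraph V} {a b : V} (h : G.Adj a b) : G.Adj b a :=
  fun h' => h (G.mark_none_symm _ _ h')

lemma Adj.ne {G : MixedGraph V} {a b : V} (h : G.Adj a b) : a ≠ b := by
  rintro rfl
  exact h (G.mark_self _)

lemma adj_of_mark {G : MixedGraph V} {a b : V} {e : EndMark} (h : G.mark a b = some e) :
    G.Adj a b := by
  simp [Adj, h]

lemma Directed.adj {G : MixedGraph V} {a b : V} (h : G.Directed a b) : G.Adj a b :=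
  adj_of_mark h.2

lemma IsCollider.symm {G : MixedGraph V} {a b c : V} (h : G.IsCollider a b c) :
    G.IsCollider c b a := ⟨h.2, h.1⟩

lemma isCollider_comm {G : MixedGraph V} {a b c : V} :
    G.IsCollider a b c ↔ G.IsCollider c b a := ⟨IsCollider.symm, IsCollider.symm⟩

lemma IsDefNonCollider.symm {G : MixedGraph V} {a b c : V} (h : G.IsDefNonCollider a b c) :
    G.IsDefNonCollider c b a := by
  obtain ⟨h1, h2, h3⟩ := h
  refine ⟨h2.symm, h1.symm, ?_⟩
  rcases h3 with h | h | ⟨h, h', h''⟩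
  · exact Or.inr (Or.inl h)
  · exact Or.inl h
  · exact Or.inr (Or.inr ⟨h', h, fun hc => h'' hc.symm⟩)

lemma IsUnshielded.symm {G : MixedGraph V} {a b c : V} (h : G.IsUnshielded a b c) :
    G.IsUnshielded c b a :=
  ⟨h.2.1.symm, h.1.symm, h.2.2.1.symm, fun hc => h.2.2.2 hc.symm⟩

lemma IsDefNonCollider.not_isCollider {G : MixedGraph V} {a b c : V}
    (h : G.IsDefNonCollider a b c) : ¬ G.IsCollider a b c := by
  rintro ⟨h1, h2⟩
  rcases h.2.2 with h | h | h
  · simp [h.1] at h1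
  · simp [h.1] at h2
  · simp [h.1] at h1

/-- A definite non-collider with an arrowhead on one side has its other edge directed out of it. -/
lemma IsDefNonCollider.directed {G : MixedGraph V} {a b c : V} (h : G.IsDefNonCollider a b c)
    (ha : G.mark a b = some EndMark.arrow) : G.Directed b c := by
  rcases h.2.2 with h | h | h
  · simp [h.1] at ha
  · exact h
  · simp [h.1] at ha

/-! ### Paths as sequences of nodes -/

/-- `v 0, …, v n` is a path of `G` all of whose consecutive triples satisfy `R`. -/
structure IsTriplePath (G : MixedGraph V) (R : V → V → V → Prop) (n : ℕ) (v : ℕ → V) : Prop where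
  adj : ∀ t, t < n → G.Adj (v t) (v (t + 1))
  inj : ∀ s t, s ≤ n → t ≤ n → v s = v t → s = t
  triple : ∀ t, t + 2 ≤ n → R (v t) (v (t + 1)) (v (t + 2))

lemma consecutive_map_range {n : ℕ} {v : ℕ → V} {a b c : V}
    (h : Consecutive ((List.range (n + 1)).map v) a b c) :
    ∃ t, t + 2 ≤ n ∧ a = v t ∧ b = v (t + 1) ∧ c = v (t + 2) := by
  obtain ⟨s, l, h⟩ := h
  have key : ∀ k, k < 3 → (s ++ [a, b, c] ++ l)[s.length + k]? = [a, b, c][k]? := by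
    intro k hk
    rw [List.append_assoc, List.getElem?_append_right (by omega),
      List.getElem?_append_left (by simpa using hk)]
    simp
  have hlen := congrArg List.length h
  simp at hlen
  refine ⟨s.length, by omega, ?_, ?_, ?_⟩
  · have := key 0 (by omega)
    rw [h] at this
    simp [List.getElem?_range (show s.length < n + 1 by omega)] at this
    exact this.symm
  · have := key 1 (by omega)
    rw [h] at this
    simp [List.getElem?_range (show s.length + 1 < n + 1 by omega)] at this
    exact this.symm
  · have := key 2 (by omega)
    rw [h] at this
    simp [List.getElem?_range (show s.length + 2 < n + 1 by omega)] at this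
    exact this.symm

lemma IsTriplePath.isPath {G : MixedGraph V} {R : V → V → V → Prop} {n : ℕ} {v : ℕ → V}
    (h : G.IsTriplePath R n v) : G.IsPath ((List.range (n + 1)).map v) (v 0) (v n) := by
  refine ⟨?_, ?_, ?_, ?_⟩
  · refine List.Nodup.map_on ?_ List.nodup_range
    intro s hs t ht hst
    simp only [List.mem_range] at hs ht
    exact h.inj s t (by omega) (by omega) hst
  · rw [List.isChain_iff_getElem]
    intro i hi
    simp at hi ⊢
    exact h.adj i (by omega)
  · simp [List.range_succ_eq_map]
  · simp [List.range_succ]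

lemma IsTriplePath.exists_list {G : MixedGraph V} {R : V → V → V → Prop} {n : ℕ} {v : ℕ → V}
    (h : G.IsTriplePath R n v) :
    ∃ p, G.IsPath p (v 0) (v n) ∧ ∀ a b c, Consecutive p a b c → R a b c := by
  refine ⟨_, h.isPath, fun a b c habc => ?_⟩
  obtain ⟨t, ht, rfl, rfl, rfl⟩ := consecutive_map_range habc
  exact h.triple t ht

lemma IsPath.exists_isTriplePath {G : MixedGraph V} {R : V → V → V → Prop} {p : List V} {x y : V}
    (hp : G.IsPath p x y) (hR : ∀ a b c, Consecutive p a b c → R a b c) :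
    ∃ n v, G.IsTriplePath R n v ∧ v 0 = x ∧ v n = y := by
  obtain ⟨h1, h2, h3, h4⟩ := hp
  have hne : p ≠ [] := by rintro rfl; simp at h3
  have hpos : 0 < p.length := List.length_pos_iff.2 hne
  have hget : ∀ t (ht : t < p.length), p.getD t x = p[t] := fun t ht => by
    simp [List.getD_eq_getElem?_getD, List.getElem?_eq_getElem ht]
  refine ⟨p.length - 1, fun t => p.getD t x, ⟨?_, ?_, ?_⟩, ?_, ?_⟩
  · intro t ht
    rw [hget t (by omega), hget (t + 1) (by omega)]
    exact List.isChain_iff_getElem.1 h2 t (by omega)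
  · intro s t hs ht hst
    rw [hget s (by omega), hget t (by omega)] at hst
    exact (List.Nodup.getElem_inj_iff h1).1 hst
  · intro t ht
    rw [hget t (by omega), hget (t + 1) (by omega), hget (t + 2) (by omega)]
    refine hR _ _ _ ⟨p.take t, p.drop (t + 3), ?_⟩
    conv_rhs => rw [← List.take_append_drop t p, List.drop_eq_getElem_cons (by omega),
      List.drop_eq_getElem_cons (by omega), List.drop_eq_getElem_cons (by omega)]
    simp
  · cases p with
    | nil => simp at hpos
    | cons a l => simpa using h3
  · refine (hget _ (by omega)).trans ?_
    rw [List.getLast?_eq_getElem?, List.getElem?_eq_getElem (by omega)] at h4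
    simpa using h4

lemma IsTriplePath.mono {G : MixedGraph V} {R R' : V → V → V → Prop} {n : ℕ} {v : ℕ → V}
    (h : G.IsTriplePath R n v)
    (hR : ∀ t, t + 2 ≤ n → R (v t) (v (t + 1)) (v (t + 2)) → R' (v t) (v (t + 1)) (v (t + 2))) :
    G.IsTriplePath R' n v :=
  ⟨h.adj, h.inj, fun t ht => hR t ht (h.triple t ht)⟩

lemma IsTriplePath.take {G : MixedGraph V} {R : V → V → V → Prop} {n m : ℕ} {v : ℕ → V}
    (h : G.IsTriplePath R n v) (hm : m ≤ n) : G.IsTriplePath R m v :=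
  ⟨fun t ht => h.adj t (by omega), fun s t hs ht => h.inj s t (by omega) (by omega),
    fun t ht => h.triple t (by omega)⟩

lemma IsTriplePath.shift {G : MixedGraph V} {R : V → V → V → Prop} {n k : ℕ} {v : ℕ → V}
    (h : G.IsTriplePath R n v) (hk : k ≤ n) : G.IsTriplePath R (n - k) (fun t => v (k + t)) :=
  ⟨fun t ht => h.adj (k + t) (by omega),
    fun s t hs ht hst => by have := h.inj (k + s) (k + t) (by omega) (by omega) hst; omega,
    fun t ht => h.triple (k + t) (by omega)⟩

lemma IsTriplePath.reverse {G : MixedGraph V} {R : V → V → V → Prop} {n : ℕ} {v : ℕ → V}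
    (h : G.IsTriplePath R n v) (hR : ∀ a b c, R a b c → R c b a) :
    G.IsTriplePath R n (fun t => v (n - t)) := by
  refine ⟨fun t ht => ?_, fun s t hs ht hst => ?_, fun t ht => ?_⟩
  · have := (h.adj (n - (t + 1)) (by omega)).symm
    rwa [show n - (t + 1) + 1 = n - t by omega] at this
  · have := h.inj (n - s) (n - t) (by omega) (by omega) hst
    omega
  · have := hR _ _ _ (h.triple (n - (t + 2)) (by omega))
    rwa [show n - (t + 2) + 2 = n - t by omega, show n - (t + 2) + 1 = n - (t + 1) by omega] at this

/-- The sequence `u 0, …, u m, v 0, v 1, …`. -/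
def concat (m : ℕ) (u v : ℕ → V) (t : ℕ) : V := if t ≤ m then u t else v (t - (m + 1))

lemma concat_le {m t : ℕ} {u v : ℕ → V} (h : t ≤ m) : concat m u v t = u t := by
  simp [concat, h]

lemma concat_add {m t : ℕ} {u v : ℕ → V} : concat m u v (m + 1 + t) = v t := by
  simp only [concat]
  rw [if_neg (by omega), show m + 1 + t - (m + 1) = t by omega]

lemma IsTriplePath.concat {G : MixedGraph V} {R : V → V → V → Prop} {m n : ℕ} {u v : ℕ → V}
    (hu : G.IsTriplePath R m u) (hv : G.IsTriplePath R n v)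
    (hdisj : ∀ s t, s ≤ m → t ≤ n → u s ≠ v t) (hadj : G.Adj (u m) (v 0))
    (h1 : ∀ t, t + 1 = m → R (u t) (u m) (v 0)) (h2 : 0 < n → R (u m) (v 0) (v 1)) :
    G.IsTriplePath R (m + 1 + n) (concat m u v) := by
  have gt : ∀ t, m < t → MixedGraph.concat m u v t = v (t - (m + 1)) := fun t ht => by
    simp only [MixedGraph.concat]; rw [if_neg (by omega)]
  refine ⟨fun t ht => ?_, fun s t hs ht hst => ?_, fun t ht => ?_⟩
  · rcases lt_trichotomy t m with h | rfl | h
    · rw [concat_le h.le, concat_le (by omega)]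
      exact hu.adj t h
    · rw [concat_le le_rfl, gt _ (by omega)]
      simpa using hadj
    · rw [gt _ h, gt _ (by omega), show t + 1 - (m + 1) = t - (m + 1) + 1 by omega]
      exact hv.adj _ (by omega)
  · rcases le_or_gt s m with hs' | hs' <;> rcases le_or_gt t m with ht' | ht'
    · rw [concat_le hs', concat_le ht'] at hst
      exact hu.inj s t hs' ht' hst
    · rw [concat_le hs', gt _ ht'] at hst
      exact absurd hst (hdisj _ _ hs' (by omega))
    · rw [concat_le ht', gt _ hs'] at hst
      exact absurd hst.symm (hdisj _ _ ht' (by omega))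
    · rw [gt _ ht', gt _ hs'] at hst
      have := hv.inj _ _ (by omega) (by omega) hst
      omega
  · rcases le_or_gt (t + 2) m with h | h
    · rw [concat_le h, concat_le (by omega), concat_le (by omega)]
      exact hu.triple t h
    · rcases lt_trichotomy (t + 1) (m + 1) with h' | h' | h'
      · obtain rfl : m = t + 1 := by omega
        rw [concat_le (by omega), concat_le le_rfl, gt _ (by omega)]
        simpa using h1 t rfl
      · obtain rfl : m = t := by omega
        rw [concat_le le_rfl, gt _ (by omega), gt _ (by omega)]
        simpa using h2 (by omega)
      · rw [gt _ (by omega), gt _ (by omega), gt _ (by omega),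
          show t + 1 - (m + 1) = t - (m + 1) + 1 by omega,
          show t + 2 - (m + 1) = t - (m + 1) + 2 by omega]
        exact hv.triple _ (by omega)

lemma isTriplePath_const (G : MixedGraph V) (R : V → V → V → Prop) (y : V) :
    G.IsTriplePath R 0 (fun _ => y) :=
  ⟨fun t ht => absurd ht (by omega), fun s t hs ht _ => by omega, fun t ht => absurd ht (by omega)⟩

/-- Appending one node to a path. -/
lemma IsTriplePath.snoc {G : MixedGraph V} {R : V → V → V → Prop} {m : ℕ} {u : ℕ → V} {y : V}
    (hu : G.IsTriplePath R m u) (hy : ∀ s, s ≤ m → u s ≠ y) (hadj : G.Adj (u m) y)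
    (h1 : ∀ t, t + 1 = m → R (u t) (u m) y) :
    G.IsTriplePath R (m + 1) (MixedGraph.concat m u (fun _ => y)) :=
  hu.concat (G.isTriplePath_const R y) (fun s _ hs _ => hy s hs) hadj h1
    (fun h => absurd h (by omega))

/-- The condition imposed on a consecutive triple of an m-connecting path of a MAG. -/
def IsOpenTriple (G : MixedGraph V) (Z : Finset V) (a b c : V) : Prop :=
  (G.IsCollider a b c → ∃ z ∈ Z, G.Ancestor b z) ∧ (¬ G.IsCollider a b c → b ∉ Z)

/-- The condition imposed on a consecutive triple of a definite m-connecting path of a PAG. -/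
def IsDefOpenTriple (G : MixedGraph V) (Z : Finset V) (a b c : V) : Prop :=
  (G.IsCollider a b c ∨ G.IsDefNonCollider a b c) ∧
    (G.IsCollider a b c → ∃ z ∈ Z, G.Ancestor b z) ∧ (G.IsDefNonCollider a b c → b ∉ Z)

lemma IsOpenTriple.symm {G : MixedGraph V} {Z : Finset V} {a b c : V}
    (h : G.IsOpenTriple Z a b c) : G.IsOpenTriple Z c b a := by
  simpa only [IsOpenTriple, isCollider_comm (a := c)] using h

lemma isOpenTriple_of_mem {G : MixedGraph V} {Z : Finset V} {a b c : V}
    (h : G.IsCollider a b c) (hb : b ∈ Z) : G.IsOpenTriple Z a b c :=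
  ⟨fun _ => ⟨b, hb, Relation.ReflTransGen.refl⟩, fun h' => absurd h h'⟩

lemma mSep_singleton_iff {G : MixedGraph V} {x y : V} {Z : Finset V} :
    G.MSep {x} {y} Z ↔
      ∀ n v, G.IsTriplePath (G.IsOpenTriple Z) n v → v 0 = x → v n = y → False := by
  simp only [MSep, Finset.mem_singleton, forall_eq]
  constructor
  · rintro h n v hv rfl rfl
    exact h hv.exists_list
  · rintro h ⟨p, hp, hp'⟩
    obtain ⟨n, v, hv, h0, hn⟩ := hp.exists_isTriplePath (R := G.IsOpenTriple Z) hp'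
    exact h n v hv h0 hn

lemma pagMSep_iff {G : MixedGraph V} {x y : V} {Z : Finset V} :
    G.PAGMSep x y Z ↔
      ∀ n v, G.IsTriplePath (G.IsDefOpenTriple Z) n v → v 0 = x → v n = y → False := by
  constructor
  · rintro h n v hv rfl rfl
    exact h hv.exists_list
  · rintro h ⟨p, hp, hp'⟩
    obtain ⟨n, v, hv, h0, hn⟩ := hp.exists_isTriplePath (R := G.IsDefOpenTriple Z) hp'
    exact h n v hv h0 hn

/-! ### Orientations in ancestral graphs -/

/-- An arrowhead at `a` would belong to `b → a`, closing a directed cycle, or to `a ↔ b`, closing an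
almost directed one. -/
lemma IsMAG.not_arrow_of_transGen {N : MixedGraph V} (hN : N.IsMAG) {a b : V}
    (h : Relation.TransGen N.Directed a b) : N.mark b a ≠ some EndMark.arrow := by
  intro hm
  rcases hN.edges b a (adj_of_mark hm) with h' | h' | h'
  · exact hN.no_directed_cycle a (h.tail h')
  · simp [h'.1] at hm
  · exact hN.no_almost_directed_cycle a b ⟨h'.2, h'.1⟩ h.to_reflTransGen

lemma Directed.not_arrow {N : MixedGraph V} {a b : V}
    (h : N.Directed a b) : N.mark b a ≠ some EndMark.arrow := by
  simp [h.1]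

/-- An edge of a MAG without an arrowhead at `a` is directed out of `a`. -/
lemma IsMAG.directed_of_not_arrow {N : MixedGraph V} (hN : N.IsMAG) {a b : V}
    (h : N.Adj a b) (h' : N.mark b a ≠ some EndMark.arrow) : N.Directed a b := by
  rcases hN.edges a b h with h | h | h
  · exact h
  · exact absurd h.2 h'
  · exact absurd h.1 h'

lemma IsMAG.directed_of_tail {N : MixedGraph V} (hN : N.IsMAG) {a b : V}
    (h : N.mark b a = some EndMark.tail) : N.Directed a b :=
  hN.directed_of_not_arrow (adj_of_mark h).symm (by simp [h])

/-- Otherwise `c → a`, so `b` would be an ancestor of `a` in spite of the arrowhead at `b`. -/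
lemma IsMAG.arrow_of_transGen {N : MixedGraph V} (hN : N.IsMAG) {a b c : V}
    (hab : N.mark a b = some EndMark.arrow) (hbc : Relation.TransGen N.Directed b c)
    (hac : N.Adj a c) : N.mark a c = some EndMark.arrow := by
  by_contra h
  have := hN.directed_of_not_arrow hac.symm h
  exact hN.not_arrow_of_transGen (hbc.tail this) hab

lemma IsMAG.arrow_of_directed {N : MixedGraph V} (hN : N.IsMAG) {a b c : V}
    (hab : N.mark a b = some EndMark.arrow) (hbc : N.Directed b c)
    (hac : N.Adj a c) : N.mark a c = some EndMark.arrow :=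
  hN.arrow_of_transGen hab (.single hbc) hac

lemma IsMAG.directed_trans {N : MixedGraph V} (hN : N.IsMAG) {a b c : V}
    (hab : N.Directed a b) (hbc : N.Directed b c) (hac : N.Adj a c) : N.Directed a c :=
  hN.directed_of_not_arrow hac
    (hN.not_arrow_of_transGen ((Relation.TransGen.single hab).tail hbc))

/-- A non-collider of a MAG is a definite non-collider. -/
lemma IsMAG.isDefNonCollider {N : MixedGraph V} (hN : N.IsMAG) {a b c : V}
    (hab : N.Adj a b) (hbc : N.Adj b c) (h : ¬ N.IsCollider a b c) : N.IsDefNonCollider a b c := by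
  refine ⟨hab, hbc, ?_⟩
  by_cases h1 : N.mark a b = some EndMark.arrow
  · exact Or.inr (Or.inl (hN.directed_of_not_arrow hbc fun h2 => h ⟨h1, h2⟩))
  · exact Or.inl (hN.directed_of_not_arrow hab.symm h1)

/-! ### Separators of non-adjacent nodes -/

/-- An outgoing edge continues as a directed path up to the first collider, which has a descendant
in `Z`, or up to the end of the path. The induction is on the number `k` of remaining edges. -/
lemma IsMAG.ancestor_of_directed_step {N : MixedGraph V} (hN : N.IsMAG) {Z : Finset V} {n : ℕ}
    {v : ℕ → V} (hv : N.IsTriplePath (N.IsOpenTriple Z) n v) :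
    ∀ k t, t + 1 + k = n → N.Directed (v t) (v (t + 1)) →
      N.Ancestor (v t) (v n) ∨ ∃ z ∈ Z, N.Ancestor (v t) z := by
  intro k
  induction k with
  | zero =>
    rintro t rfl h
    exact Or.inl (.single h)
  | succ k ih =>
    intro t ht h
    by_cases hc : N.IsCollider (v t) (v (t + 1)) (v (t + 2))
    · obtain ⟨z, hz, h'⟩ := (hv.triple t (by omega)).1 hc
      exact Or.inr ⟨z, hz, .head h h'⟩
    · have hd : N.Directed (v (t + 1)) (v (t + 2)) :=
        (hN.isDefNonCollider h.adj (hv.adj _ (by omega)) hc).directed h.2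
      rcases ih (t + 1) (by omega) hd with h' | ⟨z, hz, h'⟩
      · exact Or.inl (.head h h')
      · exact Or.inr ⟨z, hz, .head h h'⟩

/-- Inner nodes of m-connecting paths are ancestors of an endpoint or of the conditioning set. -/
lemma IsMAG.ancestor_of_isTriplePath {N : MixedGraph V} (hN : N.IsMAG) {Z : Finset V} {n : ℕ}
    {v : ℕ → V} (hv : N.IsTriplePath (N.IsOpenTriple Z) n v) {t : ℕ} (ht : t + 2 ≤ n) :
    N.Ancestor (v (t + 1)) (v 0) ∨ N.Ancestor (v (t + 1)) (v n) ∨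
      ∃ z ∈ Z, N.Ancestor (v (t + 1)) z := by
  by_cases hc : N.IsCollider (v t) (v (t + 1)) (v (t + 2))
  · exact Or.inr (Or.inr ((hv.triple t ht).1 hc))
  · rcases (hN.isDefNonCollider (hv.adj _ (by omega)) (hv.adj _ (by omega)) hc).2.2 with h | h | h
    · have hv' := hv.reverse fun a b c h => h.symm
      have := hN.ancestor_of_directed_step hv' t (n - (t + 1)) (by omega) (by
        simpa [show n - (n - (t + 1)) = t + 1 by omega,
          show n - (n - (t + 1) + 1) = t by omega] using h)
      simp only [show n - (n - (t + 1)) = t + 1 by omega, Nat.sub_self] at this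
      exact this.imp_right Or.inr
    · exact Or.inr (hN.ancestor_of_directed_step hv (n - (t + 2)) (t + 1) (by omega) h)
    · have := hN.edges _ _ (hv.adj t (by omega))
      rcases this with h' | h' | h'
      · simp [h'.2] at h
      · simp [h'.1] at h
      · simp [h'.2] at h

/-- Non-adjacent nodes of a MAG are m-separated by some set. -/
lemma IsMAG.exists_mSep [Fintype V] {N : MixedGraph V} (hN : N.IsMAG) {x y : V} (hxy : x ≠ y)
    (hadj : ¬ N.Adj x y) : ∃ S : Finset V, x ∉ S ∧ y ∉ S ∧ N.MSep {x} {y} S := by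
  classical
  -- The ancestors of the endpoints, without the endpoints, separate: on a connecting path every
  -- inner node is such an ancestor, hence a collider, and the path would be inducing.
  refine ⟨Finset.univ.filter fun z => (N.Ancestor z x ∨ N.Ancestor z y) ∧ z ≠ x ∧ z ≠ y,
    by simp, by simp, mSep_singleton_iff.2 ?_⟩
  rintro n v hv rfl rfl
  refine hN.maximal _ _ hxy hadj ?_
  have key : ∀ t, t + 2 ≤ n → N.Ancestor (v (t + 1)) (v 0) ∨ N.Ancestor (v (t + 1)) (v n) := by
    intro t ht
    rcases hN.ancestor_of_isTriplePath hv ht with h | h | ⟨z, hz, h⟩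
    · exact Or.inl h
    · exact Or.inr h
    · simp only [Finset.mem_filter] at hz
      exact hz.2.1.imp h.trans h.trans
  refine (hv.mono (R' := fun a b c => N.IsCollider a b c ∧
    (N.Ancestor b (v 0) ∨ N.Ancestor b (v n))) fun t ht h => ⟨?_, key t ht⟩).exists_list
  by_contra hc
  refine h.2 hc ?_
  simp only [Finset.mem_filter, Finset.mem_univ, true_and]
  refine ⟨key t ht, fun h => ?_, fun h => ?_⟩
  · have := hv.inj _ _ (by omega) (by omega) h
    omega
  · have := hv.inj _ _ (by omega) (by omega) h
    omega

/-! ### Discriminating sequences -/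

/-- `u 0, …, u m, y` is an unshielded triple (`m = 1`) or a discriminating path for `u m`
(`2 ≤ m`). -/
structure IsDiscriminating (G : MixedGraph V) (m : ℕ) (u : ℕ → V) (y : V) : Prop where
  pos : 0 < m
  path : G.IsTriplePath (fun a b c => G.IsCollider a b c ∧ G.Directed b y) m u
  adj : G.Adj (u m) y
  ne : u 0 ≠ y
  not_adj : ¬ G.Adj (u 0) y

lemma IsDiscriminating.directed {G : MixedGraph V} {m : ℕ} {u : ℕ → V} {y : V}
    (h : G.IsDiscriminating m u y) {k : ℕ} (hk : 0 < k) (hkm : k < m) : G.Directed (u k) y := by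
  obtain ⟨k, rfl⟩ : ∃ j, k = j + 1 := ⟨k - 1, by omega⟩
  exact (h.path.triple k (by omega)).2

lemma IsDiscriminating.node_ne {G : MixedGraph V} {m : ℕ} {u : ℕ → V} {y : V}
    (h : G.IsDiscriminating m u y) {k : ℕ} (hk : k ≤ m) : u k ≠ y := by
  rcases Nat.eq_zero_or_pos k with rfl | h0
  · exact h.ne
  · rcases hk.lt_or_eq with h1 | rfl
    · exact (h.directed h0 h1).adj.ne
    · exact h.adj.ne

/-- A path of colliders in `S`, followed by an open triple, connects. -/
lemma IsTriplePath.not_open {G : MixedGraph V} {R : V → V → V → Prop} {k : ℕ} {u : ℕ → V} {y : V}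
    (hu : G.IsTriplePath R (k + 1) u) (hadj : G.Adj (u (k + 1)) y)
    (hne : ∀ s, s ≤ k + 1 → u s ≠ y)
    (hsep : ∀ n v, G.IsTriplePath R n v → v 0 = u 0 → v n = y → False) :
    ¬ R (u k) (u (k + 1)) y := by
  intro h
  refine hsep _ _ (hu.snoc hne hadj fun t ht => ?_) (concat_le (by omega)) ?_
  · obtain rfl : t = k := by omega
    exact h
  · simp [MixedGraph.concat]

/-- Every separator of the endpoints contains the inner nodes of a discriminating sequence. -/
lemma IsDiscriminating.mem_of_sep {G : MixedGraph V} {m : ℕ} {u : ℕ → V} {y : V}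
    (h : G.IsDiscriminating m u y) {S : Finset V} (R : V → V → V → Prop)
    (hR : ∀ a b c, G.IsCollider a b c → b ∈ S → R a b c)
    (hR' : ∀ a b c, G.IsDefNonCollider a b c → b ∉ S → R a b c)
    (hsep : ∀ n v, G.IsTriplePath R n v → v 0 = u 0 → v n = y → False) :
    ∀ k, 0 < k → k < m → u k ∈ S := by
  intro k
  induction k using Nat.strong_induction_on with
  | _ k ih =>
    intro hk hkm
    obtain ⟨k, rfl⟩ : ∃ j, k = j + 1 := ⟨k - 1, by omega⟩
    -- Outside `S`, the non-collider `u (k + 1) → y` would complete an open path, the earlier nodes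
    -- being colliders in `S`.
    by_contra hmem
    have hp : G.IsTriplePath R (k + 1) u :=
      (h.path.take hkm.le).mono fun t ht h' => hR _ _ _ h'.1 (ih _ (by omega) (by omega) (by omega))
    have hd := h.directed hk hkm
    exact hp.not_open hd.adj (fun s hs => h.node_ne (by omega)) hsep
      (hR' _ _ _ ⟨hp.adj _ (by omega), hd.adj, Or.inr (Or.inl hd)⟩ hmem)

/-- Every separator of the endpoints of a discriminating sequence in a PAG contains its
discriminated node if that is a definite non-collider. -/
lemma IsDiscriminating.mem_of_pagMSep {G : MixedGraph V} {m : ℕ} {u : ℕ → V} {y : V}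
    (h : G.IsDiscriminating (m + 1) u y) (hd : G.IsDefNonCollider (u m) (u (m + 1)) y)
    {S : Finset V} (hsep : G.PAGMSep (u 0) y S) : u (m + 1) ∈ S := by
  rw [pagMSep_iff] at hsep
  have hR : ∀ a b c, G.IsCollider a b c → b ∈ S → G.IsDefOpenTriple S a b c := fun a b c hc hb =>
    ⟨Or.inl hc, fun _ => ⟨b, hb, .refl⟩, fun h' => absurd hc h'.not_isCollider⟩
  have hR' : ∀ a b c, G.IsDefNonCollider a b c → b ∉ S → G.IsDefOpenTriple S a b c :=
    fun a b c hc hb => ⟨Or.inr hc, fun h' => absurd h' hc.not_isCollider, fun _ => hb⟩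
  by_contra hmem
  have hp : G.IsTriplePath (G.IsDefOpenTriple S) (m + 1) u :=
    h.path.mono fun t ht h' => hR _ _ _ h'.1
      (h.mem_of_sep _ hR hR' hsep _ (by omega) (by omega))
  exact hp.not_open h.adj (fun s hs => h.node_ne hs) hsep (hR' _ _ _ hd hmem)

/-! ### Invariance within a Markov equivalence class -/

lemma MarkovEquiv.mSep_singleton_iff {M N : MixedGraph V} (h : MarkovEquiv M N) {x y : V}
    {Z : Finset V} (hxy : x ≠ y) (hx : x ∉ Z) (hy : y ∉ Z) :
    M.MSep {x} {y} Z ↔ N.MSep {x} {y} Z :=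
  h _ _ _ (by simpa using hxy) (by simpa using hx) (by simpa using hy)

lemma markovEquiv_refl (M : MixedGraph V) : MarkovEquiv M M := fun _ _ _ _ _ _ => Iff.rfl

/-- A discriminating sequence of a MAG all of whose inner nodes are colliders in a Markov equivalent
MAG is discriminating there, and the discriminated node has the same status in both. -/
lemma IsDiscriminating.markovEquiv [Fintype V] {N N' : MixedGraph V} (hN : N.IsMAG)
    (hN' : N'.IsMAG) (hadj : ∀ a b, N.Adj a b ↔ N'.Adj a b) (he : MarkovEquiv N N') {m : ℕ}
    {u : ℕ → V} {y : V} (h : N.IsDiscriminating (m + 1) u y)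
    (hc : ∀ t, t + 2 ≤ m + 1 → N'.IsCollider (u t) (u (t + 1)) (u (t + 2))) :
    N'.IsDiscriminating (m + 1) u y ∧
      (N.IsCollider (u m) (u (m + 1)) y ↔ N'.IsCollider (u m) (u (m + 1)) y) := by
  obtain ⟨S, hx, hy, hS⟩ := hN.exists_mSep h.ne h.not_adj
  have hS' := (he.mSep_singleton_iff h.ne hx hy).1 hS
  rw [MixedGraph.mSep_singleton_iff] at hS hS'
  have hR : ∀ {G : MixedGraph V} a b c, G.IsCollider a b c → b ∈ S → G.IsOpenTriple S a b c :=
    fun a b c hc hb => isOpenTriple_of_mem hc hb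
  have hR' : ∀ {G : MixedGraph V} a b c, ¬ G.IsCollider a b c → b ∉ S → G.IsOpenTriple S a b c :=
    fun a b c hc hb => ⟨fun h' => absurd h' hc, fun _ => hb⟩
  have hmem := h.mem_of_sep _ hR (fun a b c hd => hR' a b c hd.not_isCollider) hS
  have hp : N.IsTriplePath (N.IsOpenTriple S) (m + 1) u :=
    h.path.mono fun t ht h' => hR _ _ _ h'.1 (hmem _ (by omega) (by omega))
  have hp' : N'.IsTriplePath (N'.IsOpenTriple S) (m + 1) u :=
    ⟨fun t ht => (hadj _ _).1 (h.path.adj t ht), h.path.inj,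
      fun t ht => hR _ _ _ (hc t ht) (hmem _ (by omega) (by omega))⟩
  have hne : ∀ s, s ≤ m + 1 → u s ≠ y := fun s hs => h.node_ne hs
  have hd : ∀ t, t + 2 ≤ m + 1 → N'.Directed (u (t + 1)) y := by
    intro t ht
    have hadj' := (hadj _ _).1 (h.directed (k := t + 1) (by omega) (by omega)).adj
    have := (hp'.take (m := t + 1) (by omega)).not_open hadj'
      (fun s hs => hne s (by omega)) hS'
    refine hN'.directed_of_not_arrow hadj' fun ha => this (hR _ _ _ ⟨(hc t ht).1, ha⟩ ?_)
    exact hmem _ (by omega) (by omega)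
  have hadj' := (hadj _ _).1 h.adj
  -- In either graph the last triple is blocked by `S`, so its middle node is in `S` exactly when it
  -- is a non-collider there; `S` is the same for both.
  have o := hp.not_open h.adj hne hS
  have o' := hp'.not_open hadj' hne hS'
  refine ⟨⟨h.pos, ⟨hp'.adj, hp'.inj, fun t ht => ⟨hc t ht, hd t ht⟩⟩, hadj', h.ne,
    fun h' => h.not_adj ((hadj _ _).2 h')⟩, fun hcol => ?_, fun hcol => ?_⟩
  · by_contra hcol'
    exact o' (hR' _ _ _ hcol' fun hm => o (hR _ _ _ hcol hm))
  · by_contra hcol'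
    exact o (hR' _ _ _ hcol' fun hm => o' (hR _ _ _ hcol hm))

lemma IsPAGOf.adj_iff {P N : MixedGraph V} (hP : P.IsPAGOf N) (hN : N.IsMAG) (a b : V) :
    P.Adj a b ↔ N.Adj a b := hP.adj N hN (markovEquiv_refl N) a b

lemma IsPAGOf.isCollider {P N N' : MixedGraph V} (hP : P.IsPAGOf N) (hN' : N'.IsMAG)
    (he : MarkovEquiv N N') {a b c : V} (h : P.IsCollider a b c) : N'.IsCollider a b c :=
  ⟨(hP.arrow _ _).1 h.1 N' hN' he, (hP.arrow _ _).1 h.2 N' hN' he⟩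

lemma IsPAGOf.directed {P N N' : MixedGraph V} (hP : P.IsPAGOf N) (hN' : N'.IsMAG)
    (he : MarkovEquiv N N') {a b : V} (h : P.Directed a b) : N'.Directed a b :=
  ⟨(hP.tail _ _).1 h.1 N' hN' he, (hP.arrow _ _).1 h.2 N' hN' he⟩

lemma IsPAGOf.directed_of_forall {P N : MixedGraph V} (hP : P.IsPAGOf N) {a b : V}
    (h : ∀ N' : MixedGraph V, N'.IsMAG → MarkovEquiv N N' → N'.Directed a b) : P.Directed a b :=
  ⟨(hP.tail _ _).2 fun N' h1 h2 => (h N' h1 h2).1, (hP.arrow _ _).2 fun N' h1 h2 => (h N' h1 h2).2⟩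

/-- A tail at `b` directs its own edge out of `b` in all MAGs of the class, and an arrowhead at `b`
directs the other edge out. Otherwise both marks at `b` are circles, and the triple is unshielded.
-/
lemma IsPAGOf.isDefNonCollider_of_forall {P N : MixedGraph V} (hP : P.IsPAGOf N)
    {a b c : V} (hab : P.Adj a b) (hbc : P.Adj b c) (hac : ¬ P.Adj a c)
    (h : ∀ N' : MixedGraph V, N'.IsMAG → MarkovEquiv N N' → ¬ N'.IsCollider a b c) :
    P.IsDefNonCollider a b c := by
  have key : ∀ {a b c : V}, P.Adj a b → P.Adj b c →
      (∀ N' : MixedGraph V, N'.IsMAG → MarkovEquiv N N' → ¬ N'.IsCollider a b c) →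
      P.Directed b a ∨ P.Directed b c ∨ P.mark a b = some EndMark.circle := by
    intro a b c hab hbc h
    rcases hm : P.mark a b with _ | e
    · exact absurd hm hab
    · cases e with
      | tail =>
        exact Or.inl (hP.directed_of_forall fun N' h1 h2 =>
          h1.directed_of_tail ((hP.tail _ _).1 hm N' h1 h2))
      | arrow =>
        refine Or.inr (Or.inl (hP.directed_of_forall fun N' h1 h2 =>
          h1.directed_of_not_arrow ((hP.adj N' h1 h2 _ _).1 hbc) fun h' =>
            h N' h1 h2 ⟨(hP.arrow _ _).1 hm N' h1 h2, h'⟩))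
      | circle => exact Or.inr (Or.inr rfl)
  refine ⟨hab, hbc, ?_⟩
  rcases key hab hbc h with h1 | h1 | h1
  · exact Or.inl h1
  · exact Or.inr (Or.inl h1)
  rcases key hbc.symm hab.symm (fun N' h1 h2 h3 => h N' h1 h2 h3.symm) with h2 | h2 | h2
  · exact Or.inr (Or.inl h2)
  · exact Or.inl h2
  · exact Or.inr (Or.inr ⟨h1, h2, hac⟩)

/-- A discriminating sequence of a MAG whose inner nodes are colliders in the PAG is discriminating
in the PAG, which shows the status of the discriminated node. -/
lemma IsPAGOf.isDiscriminating [Fintype V] {P N : MixedGraph V} (hP : P.IsPAGOf N) (hN : N.IsMAG)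
    {m : ℕ} {u : ℕ → V} {y : V} (h : N.IsDiscriminating (m + 1) u y)
    (hc : ∀ t, t + 2 ≤ m + 1 → P.IsCollider (u t) (u (t + 1)) (u (t + 2))) :
    P.IsDiscriminating (m + 1) u y ∧
      (N.IsCollider (u m) (u (m + 1)) y → P.IsCollider (u m) (u (m + 1)) y) ∧
      (¬ N.IsCollider (u m) (u (m + 1)) y → P.IsDefNonCollider (u m) (u (m + 1)) y) := by
  have key : ∀ N' : MixedGraph V, N'.IsMAG → MarkovEquiv N N' →
      N'.IsDiscriminating (m + 1) u y ∧
      (N.IsCollider (u m) (u (m + 1)) y ↔ N'.IsCollider (u m) (u (m + 1)) y) :=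
    fun N' h1 h2 => h.markovEquiv hN h1
      (fun a b => (hP.adj_iff hN a b).symm.trans (hP.adj N' h1 h2 a b)) h2
      (fun t ht => hP.isCollider h1 h2 (hc t ht))
  have hadj := fun a b => hP.adj_iff hN a b
  refine ⟨⟨h.pos, ⟨fun t ht => (hadj _ _).2 (h.path.adj t ht), h.path.inj, fun t ht => ⟨hc t ht,
    hP.directed_of_forall fun N' h1 h2 => ((key N' h1 h2).1.path.triple t ht).2⟩⟩,
    (hadj _ _).2 h.adj, h.ne, fun h' => h.not_adj ((hadj _ _).1 h')⟩, fun hcol => ?_, fun hcol => ?_⟩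
  · exact ⟨(hP.arrow _ _).2 fun N' h1 h2 => ((key N' h1 h2).2.1 hcol).1,
      (hP.arrow _ _).2 fun N' h1 h2 => ((key N' h1 h2).2.1 hcol).2⟩
  · have hncol : ∀ N' : MixedGraph V, N'.IsMAG → MarkovEquiv N N' →
        ¬ N'.IsCollider (u m) (u (m + 1)) y := fun N' h1 h2 h3 => hcol ((key N' h1 h2).2.2 h3)
    have ha := (hadj _ _).2 (h.path.adj m (by omega))
    have ha' := (hadj _ _).2 h.adj
    rcases Nat.eq_zero_or_pos m with rfl | hm
    · exact hP.isDefNonCollider_of_forall ha ha' (fun h' => h.not_adj ((hadj _ _).1 h')) hncol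
    · refine ⟨ha, ha', Or.inr (Or.inl (hP.directed_of_forall fun N' h1 h2 => ?_))⟩
      have hd := (key N' h1 h2).1.directed hm (by omega)
      rcases (h1.isDefNonCollider ((hP.adj N' h1 h2 _ _).1 ha) ((hP.adj N' h1 h2 _ _).1 ha')
        (hncol N' h1 h2)).2.2 with h3 | h3 | h3
      -- If the edge to `u m` leaves `u (m + 1)`, then `u (m + 1) → u m → y` forces `u (m + 1) → y`
      -- too.
      · exact h1.directed_trans h3 hd ((hP.adj N' h1 h2 _ _).1 ha')
      · exact h3
      · exact absurd hd.adj h3.2.2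

/-- An unshielded triple is a discriminating sequence. -/
lemma IsUnshielded.isDiscriminating {G : MixedGraph V} {a b c : V} (h : G.IsUnshielded a b c) :
    G.IsDiscriminating 1 (fun t => if t = 0 then a else b) c := by
  refine ⟨one_pos, ⟨fun t ht => ?_, fun s t hs ht hst => ?_, fun t ht => absurd ht (by omega)⟩,
    by simpa using h.2.1, by simpa using h.2.2.1, by simpa using h.2.2.2⟩
  · obtain rfl : t = 0 := by omega
    simpa using h.1
  · have := h.1.ne
    interval_cases s <;> interval_cases t <;> simp_all

lemma IsPAGOf.isUnshielded [Fintype V] {P N : MixedGraph V} (hP : P.IsPAGOf N) (hN : N.IsMAG)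
    {a b c : V} (h : N.IsUnshielded a b c) :
    (N.IsCollider a b c → P.IsCollider a b c) ∧
      (¬ N.IsCollider a b c → P.IsDefNonCollider a b c) := by
  simpa using (hP.isDiscriminating hN (m := 0) h.isDiscriminating
    (fun t ht => absurd ht (by omega))).2

/-- Definite non-colliders of a PAG are non-colliders in the MAGs of the class. -/
lemma IsPAGOf.not_isCollider [Fintype V] {P N : MixedGraph V} (hP : P.IsPAGOf N) (hN : N.IsMAG)
    {a b c : V} (hac : a ≠ c) (h : P.IsDefNonCollider a b c) : ¬ N.IsCollider a b c := by
  rintro hc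
  obtain ⟨h1, h2, h3⟩ := h
  rcases h3 with h3 | h3 | ⟨h3, -, h4⟩
  · simpa [(hP.directed hN (markovEquiv_refl N) h3).1] using hc.1
  · simpa [(hP.directed hN (markovEquiv_refl N) h3).1] using hc.2
  · have := ((hP.isUnshielded hN ⟨(hP.adj_iff hN _ _).1 h1, (hP.adj_iff hN _ _).1 h2, hac,
      fun h => h4 ((hP.adj_iff hN _ _).2 h)⟩).1 hc).1
    simp [this] at h3

lemma IsPAGOf.ancestor {P N : MixedGraph V} (hP : P.IsPAGOf N) (hN : N.IsMAG) {a b : V}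
    (h : P.Ancestor a b) : N.Ancestor a b :=
  Relation.ReflTransGen.mono (fun _ _ h' => hP.directed hN (markovEquiv_refl N) h') _ _ h

/-- Definite m-connecting paths of a PAG are m-connecting in the MAGs of the class. -/
lemma IsPAGOf.isTriplePath [Fintype V] {P N : MixedGraph V} (hP : P.IsPAGOf N) (hN : N.IsMAG)
    {Z : Finset V} {n : ℕ} {v : ℕ → V} (h : P.IsTriplePath (P.IsDefOpenTriple Z) n v) :
    N.IsTriplePath (N.IsOpenTriple Z) n v := by
  refine ⟨fun t ht => (hP.adj_iff hN _ _).1 (h.adj t ht), h.inj, fun t ht => ?_⟩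
  obtain ⟨h1, h2, h3⟩ := h.triple t ht
  rcases h1 with h1 | h1
  · obtain ⟨z, hz, h4⟩ := h2 h1
    exact ⟨fun _ => ⟨z, hz, hP.ancestor hN h4⟩,
      fun h' => absurd (hP.isCollider hN (markovEquiv_refl N) h1) h'⟩
  · have hne : v t ≠ v (t + 2) := fun h' => by
      have := h.inj _ _ (by omega) (by omega) h'
      omega
    exact ⟨fun h' => absurd h' (hP.not_isCollider hN hne h1), fun _ => h3 h1⟩

/-- Non-adjacent nodes of a PAG are m-separated by some set. -/
lemma IsPAGOf.exists_pagMSep [Fintype V] {P N : MixedGraph V} (hP : P.IsPAGOf N) (hN : N.IsMAG)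
    {x y : V} (hxy : x ≠ y) (hadj : ¬ P.Adj x y) :
    ∃ S : Finset V, x ∉ S ∧ y ∉ S ∧ P.PAGMSep x y S := by
  obtain ⟨S, hx, hy, hS⟩ := hN.exists_mSep hxy fun h => hadj ((hP.adj_iff hN _ _).2 h)
  rw [mSep_singleton_iff] at hS
  exact ⟨S, hx, hy, pagMSep_iff.2 fun n v hv => hS n v (hP.isTriplePath hN hv)⟩

lemma IsPAGOf.exists_minSep [Fintype V] {P N : MixedGraph V} (hP : P.IsPAGOf N) (hN : N.IsMAG)
    {x y : V} (hxy : x ≠ y) (hadj : ¬ P.Adj x y) : ∃ S, S ∈ P.MinSep x y := by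
  obtain ⟨S, hx, hy, hS⟩ := hP.exists_pagMSep hN hxy hadj
  obtain ⟨T, ⟨hT, hTS⟩, hmin⟩ := WellFounded.has_min (α := Finset V) wellFounded_lt
    {T | P.PAGMSep x y T ∧ T ⊆ S} ⟨S, hS, subset_rfl⟩
  exact ⟨T, hxy, hadj, fun h => hx (hTS h), fun h => hy (hTS h), hT,
    fun W hW hW' => hmin W ⟨hW', hW.subset.trans hTS⟩ hW⟩

/-! ### Triples with order -/

/-- `⟨a, b, c⟩` is a collider (`true`) or non-collider (`false`) triple obtained from unshielded
triples by the recursion defining triples with order. -/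
inductive HasOrder (G : MixedGraph V) : Bool → V → V → V → Prop
  | collider {a b c : V} : G.IsUnshielded a b c → G.IsCollider a b c → HasOrder G true a b c
  | nonCollider {a b c : V} :
      G.IsUnshielded a b c → G.IsDefNonCollider a b c → HasOrder G false a b c
  | collider_step {q a b c : V} : a ≠ c → G.IsCollider a b c → HasOrder G true q a b →
      HasOrder G false q a c → HasOrder G true a b c
  | nonCollider_step {q a b c : V} : a ≠ c → G.IsDefNonCollider a b c → HasOrder G true q a b →
      HasOrder G false q a c → HasOrder G false a b c
  | symm {e : Bool} {a b c : V} : HasOrder G e a b c → HasOrder G e c b a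

lemma ColliderOfOrder.symm {G : MixedGraph V} : ∀ {i : ℕ} {a b c : V},
    G.ColliderOfOrder i a b c → G.ColliderOfOrder i c b a := by
  intro i
  induction i using Nat.strong_induction_on with
  | _ i ih =>
    intro a b c h
    rw [ColliderOfOrder] at h ⊢
    rcases h with ⟨h1, h2, h3⟩ | ⟨h1, h2, h3, h4, h5⟩
    · exact Or.inl ⟨h1, h2.symm, h3.symm⟩
    · exact Or.inr ⟨h1, fun j hj => h2 j (ih j j.2 hj), h3.symm, h4.symm, h5.symm⟩

lemma NonColliderOfOrder.symm {G : MixedGraph V} : ∀ {i : ℕ} {a b c : V},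
    G.NonColliderOfOrder i a b c → G.NonColliderOfOrder i c b a := by
  intro i
  induction i using Nat.strong_induction_on with
  | _ i ih =>
    intro a b c h
    rw [NonColliderOfOrder] at h ⊢
    rcases h with ⟨h1, h2, h3⟩ | ⟨h1, h2, h3, h4, h5⟩
    · exact Or.inl ⟨h1, h2.symm, h3.symm⟩
    · exact Or.inr ⟨h1, fun j hj => h2 j (ih j j.2 hj), h3.symm, h4.symm, h5.symm⟩

/-- The definition by order demands that no smaller order applies. If the triple had no order at
all, that demand would hold trivially and order `max j k + 1` would apply. -/
lemma HasOrder.exists_order {G : MixedGraph V} {e : Bool} {a b c : V} (h : G.HasOrder e a b c) :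
    ∃ i, if e then G.ColliderOfOrder i a b c else G.NonColliderOfOrder i a b c := by
  induction h with
  | collider h1 h2 =>
    refine ⟨0, ?_⟩
    rw [if_pos rfl, ColliderOfOrder]
    exact Or.inl ⟨rfl, h1, h2⟩
  | nonCollider h1 h2 =>
    refine ⟨0, ?_⟩
    rw [if_neg (by simp), NonColliderOfOrder]
    exact Or.inl ⟨rfl, h1, h2⟩
  | @collider_step q a b c hne hc _ _ ih1 ih2 =>
    obtain ⟨j, hj⟩ := ih1
    obtain ⟨k, hk⟩ := ih2
    rw [if_pos rfl] at hj
    rw [if_neg (by simp)] at hk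
    simp only [if_true]
    by_contra hcon
    push Not at hcon
    refine hcon (max j k + 1) ?_
    rw [ColliderOfOrder]
    exact Or.inr ⟨by omega, fun i => hcon i, hne, hc,
      Or.inl ⟨q, ⟨⟨j, by omega⟩, hj⟩, ⟨⟨k, by omega⟩, hk⟩⟩⟩
  | @nonCollider_step q a b c hne hc _ _ ih1 ih2 =>
    obtain ⟨j, hj⟩ := ih1
    obtain ⟨k, hk⟩ := ih2
    rw [if_pos rfl] at hj
    rw [if_neg (by simp)] at hk
    simp only [Bool.false_eq_true, if_false]
    by_contra hcon
    push Not at hcon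
    refine hcon (max j k + 1) ?_
    rw [NonColliderOfOrder]
    exact Or.inr ⟨by omega, fun i => hcon i, hne, hc,
      Or.inl ⟨q, ⟨⟨j, by omega⟩, hj⟩, ⟨⟨k, by omega⟩, hk⟩⟩⟩
  | @symm e a b c _ ih =>
    obtain ⟨i, hi⟩ := ih
    refine ⟨i, ?_⟩
    cases e
    · simpa using NonColliderOfOrder.symm (by simpa using hi)
    · simpa using ColliderOfOrder.symm (by simpa using hi)

lemma HasOrder.nonColliderWithOrder {G : MixedGraph V} {a b c : V} (h : G.HasOrder false a b c) :
    G.NonColliderWithOrder a b c := by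
  obtain ⟨i, hi⟩ := h.exists_order
  exact ⟨i, by simpa using hi⟩

/-- Discriminating sequences whose inner triples have order end in triples with order. -/
lemma IsDiscriminating.hasOrder {G : MixedGraph V} {u : ℕ → V} {y : V} {m : ℕ}
    (h : G.IsDiscriminating (m + 1) u y)
    (ho : ∀ t, t + 2 ≤ m + 1 → G.HasOrder true (u t) (u (t + 1)) (u (t + 2))) :
    (G.IsCollider (u m) (u (m + 1)) y → G.HasOrder true (u m) (u (m + 1)) y) ∧
      (G.IsDefNonCollider (u m) (u (m + 1)) y → G.HasOrder false (u m) (u (m + 1)) y) := by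
  induction m with
  | zero =>
    have hu : G.IsUnshielded (u 0) (u 1) y := ⟨h.path.adj 0 one_pos, h.adj, h.ne, h.not_adj⟩
    exact ⟨.collider hu, .nonCollider hu⟩
  | succ m ih =>
    have hd := h.directed (k := m + 1) (by omega) (by omega)
    -- The shorter sequence ending in `u (m + 1) → y` gives the non-collider triple, so that `q = u
    -- m` witnesses the recursion.
    have h' := (ih ⟨by omega, h.path.take (by omega), hd.adj, h.ne, h.not_adj⟩
      (fun t ht => ho t (by omega))).2
      ⟨h.path.adj _ (by omega), hd.adj, Or.inr (Or.inl hd)⟩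
    have h1 := ho m (by omega)
    exact ⟨fun hc => .collider_step hd.adj.ne hc h1 h', fun hc => .nonCollider_step hd.adj.ne hc h1 h'⟩

/-- `⟨a, b, c⟩` or its reversal is the end of a discriminating sequence for `b`. -/
def EndsDiscriminating (G : MixedGraph V) (a b c : V) : Prop :=
  ∃ m u y, G.IsDiscriminating (m + 1) u y ∧ u (m + 1) = b ∧ ((u m = a ∧ y = c) ∨ (u m = c ∧ y = a))

/-- The PAG `P` shows the status of the triple `⟨a, b, c⟩` of the MAG `N`, with order. -/
def IsSettled (P N : MixedGraph V) (a b c : V) : Prop :=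
  (N.IsCollider a b c → P.IsCollider a b c ∧ P.HasOrder true a b c) ∧
    (¬ N.IsCollider a b c →
      P.IsDefNonCollider a b c ∧ P.HasOrder false a b c ∧ P.EndsDiscriminating a b c)

lemma IsSettled.symm {P N : MixedGraph V} {a b c : V} (h : IsSettled P N a b c) :
    IsSettled P N c b a := by
  refine ⟨fun hc => ?_, fun hc => ?_⟩
  · exact ⟨(h.1 hc.symm).1.symm, (h.1 hc.symm).2.symm⟩
  · obtain ⟨h1, h2, m, u, y, h3, h4, h5⟩ := h.2 fun h' => hc h'.symm
    exact ⟨h1.symm, h2.symm, m, u, y, h3, h4, h5.symm⟩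

lemma IsPAGOf.isSettled_of_isDiscriminating [Fintype V] {P N : MixedGraph V} (hP : P.IsPAGOf N)
    (hN : N.IsMAG) {m : ℕ} {u : ℕ → V} {y : V} (h : N.IsDiscriminating (m + 1) u y)
    (hs : ∀ t, t + 2 ≤ m + 1 → IsSettled P N (u t) (u (t + 1)) (u (t + 2))) :
    IsSettled P N (u m) (u (m + 1)) y := by
  have hs' := fun t ht => (hs t ht).1 (h.path.triple t ht).1
  obtain ⟨h1, h2, h3⟩ := hP.isDiscriminating hN h fun t ht => (hs' t ht).1
  obtain ⟨h4, h5⟩ := h1.hasOrder fun t ht => (hs' t ht).2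
  exact ⟨fun hc => ⟨h2 hc, h4 (h2 hc)⟩,
    fun hc => ⟨h3 hc, h5 (h3 hc), m, u, y, h1, rfl, Or.inl ⟨rfl, rfl⟩⟩⟩

/-! ### Shortest m-connecting paths -/

/-- `v 0, …, v n` is a shortest m-connecting path between its endpoints. -/
structure IsShortest (N : MixedGraph V) (W : Finset V) (n : ℕ) (v : ℕ → V) : Prop where
  path : N.IsTriplePath (N.IsOpenTriple W) n v
  le : ∀ n' v', N.IsTriplePath (N.IsOpenTriple W) n' v' → v' 0 = v 0 → v' n' = v n → n ≤ n'

lemma IsTriplePath.reverse_open {N : MixedGraph V} {W : Finset V} {n : ℕ} {v : ℕ → V}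
    (h : N.IsTriplePath (N.IsOpenTriple W) n v) :
    N.IsTriplePath (N.IsOpenTriple W) n (fun t => v (n - t)) :=
  h.reverse fun _ _ _ h' => h'.symm

lemma IsShortest.reverse {N : MixedGraph V} {W : Finset V} {n : ℕ} {v : ℕ → V}
    (h : N.IsShortest W n v) : N.IsShortest W n (fun t => v (n - t)) := by
  refine ⟨h.path.reverse_open, fun n' v' hv' h0 hn => h.le n' _ hv'.reverse_open ?_ ?_⟩
  · simpa using hn
  · simpa using h0

/-- Following a path backwards from `v (s + 1) → y` along colliders that are parents of `y`, one
arrives at a node that is not adjacent to `y` or from which the path can be continued to `y`. -/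
lemma IsTriplePath.scan {N : MixedGraph V} (hN : N.IsMAG) {W : Finset V} {n : ℕ} {v : ℕ → V}
    (hv : N.IsTriplePath (N.IsOpenTriple W) n v) {y : V} :
    ∀ s, s + 1 ≤ n → N.mark (v s) (v (s + 1)) = some EndMark.arrow → N.Directed (v (s + 1)) y →
      ∃ j, j ≤ s ∧ v j ≠ y ∧
        (∀ k, j ≤ k → k < s →
          N.Directed (v (k + 1)) y ∧ N.IsCollider (v k) (v (k + 1)) (v (k + 2))) ∧
        (¬ N.Adj (v j) y ∨ N.mark (v j) y = some EndMark.arrow ∧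
          ∀ t, t + 1 = j → N.IsOpenTriple W (v t) (v j) y) := by
  intro s
  induction s with
  | zero =>
    intro hs ha hd
    refine ⟨0, le_rfl, ?_, fun k _ hk => absurd hk (by omega), ?_⟩
    · rintro rfl
      simp [hd.1] at ha
    · by_cases hadj : N.Adj (v 0) y
      · exact Or.inr ⟨hN.arrow_of_directed ha hd hadj, fun t ht => absurd ht (by omega)⟩
      · exact Or.inl hadj
  | succ s ih =>
    intro hs ha hd
    have hne : v (s + 1) ≠ y := by
      rintro rfl
      simp [hd.1] at ha
    by_cases hadj : N.Adj (v (s + 1)) y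
    swap
    · exact ⟨s + 1, le_rfl, hne, fun k _ hk => absurd hk (by omega), Or.inl hadj⟩
    by_cases hopen : N.IsOpenTriple W (v s) (v (s + 1)) y
    · refine ⟨s + 1, le_rfl, hne, fun k _ hk => absurd hk (by omega),
        Or.inr ⟨hN.arrow_of_directed ha hd hadj, fun t ht => ?_⟩⟩
      obtain rfl : t = s := by omega
      exact hopen
    have hp := hv.triple s (by omega)
    -- If the triple were blocked as a collider towards `y`, ancestrality would make it a collider
    -- on the path too, hence open. So it is a collider on the path and a non-collider towards `y`.
    have hncol : ¬ N.IsCollider (v s) (v (s + 1)) y := by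
      intro hc
      refine hopen ⟨fun _ => hp.1 ⟨hc.1, ?_⟩, fun h => absurd hc h⟩
      by_contra h
      have := hN.directed_of_not_arrow (hv.adj (s + 1) (by omega)) h
      exact hN.not_arrow_of_transGen ((Relation.TransGen.single this).tail hd) hc.2
    have hcol : N.IsCollider (v s) (v (s + 1)) (v (s + 2)) := by
      by_contra hc
      exact hopen ⟨fun h => absurd h hncol, fun _ => hp.2 hc⟩
    have hd' : N.Directed (v (s + 1)) y :=
      hN.directed_of_not_arrow hadj fun h => hncol ⟨hcol.1, h⟩
    obtain ⟨j, hj, hj0, hj1, hj2⟩ := ih (by omega) hcol.1 hd'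
    refine ⟨j, by omega, hj0, fun k hk hks => ?_, hj2⟩
    rcases (Nat.lt_succ_iff.1 hks).lt_or_eq with h | rfl
    · exact hj1 k hk h
    · exact ⟨hd', hcol⟩

/-- `v j, …, v (t + 1), v (t + 2)` is a discriminating path for `v (t + 1)`, or an unshielded
triple. -/
def LeftDiscriminated (N : MixedGraph V) (v : ℕ → V) (j t : ℕ) : Prop :=
  j ≤ t ∧ ¬ N.Adj (v j) (v (t + 2)) ∧ ∀ k, j ≤ k → k < t →
    N.Directed (v (k + 1)) (v (t + 2)) ∧ N.IsCollider (v k) (v (k + 1)) (v (k + 2))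

/-- `v j, …, v (t + 1), v t` is a discriminating path for `v (t + 1)`, or an unshielded triple. -/
def RightDiscriminated (N : MixedGraph V) (v : ℕ → V) (j t : ℕ) : Prop :=
  t + 2 ≤ j ∧ ¬ N.Adj (v j) (v t) ∧ ∀ k, t < k → k + 2 ≤ j →
    N.Directed (v (k + 1)) (v t) ∧ N.IsCollider (v k) (v (k + 1)) (v (k + 2))

lemma rightDiscriminated_of_reverse {N : MixedGraph V} {n j t : ℕ} {v : ℕ → V} (ht : t + 2 ≤ n)
    (h : N.LeftDiscriminated (fun s => v (n - s)) j (n - (t + 2))) :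
    N.RightDiscriminated v (n - j) t := by
  obtain ⟨h1, h2, h3⟩ := h
  simp only [show n - (n - (t + 2) + 2) = t by omega] at h2 h3
  refine ⟨by omega, h2, fun k hk hkj => ?_⟩
  have := h3 (n - (k + 2)) (by omega) (by omega)
  simp only [show n - (n - (k + 2) + 2) = k by omega, show n - (n - (k + 2) + 1) = k + 1 by omega,
    show n - (n - (k + 2)) = k + 2 by omega] at this
  exact ⟨this.1, this.2.symm⟩

/-- The shortcut past `v (t + 2)` is blocked at `v (t + 1)` only if this node is a collider on the
path and a parent of `v (t + 3)`. Scanning backwards from there must end at a node not adjacent to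
`v (t + 3)`, as the other outcome is a shorter connecting path. -/
lemma IsShortest.leftDiscriminated {N : MixedGraph V} (hN : N.IsMAG) {W : Finset V} {n : ℕ}
    {v : ℕ → V} (h : N.IsShortest W n v) {t : ℕ} (ht : t + 3 ≤ n)
    (hadj : N.Adj (v (t + 1)) (v (t + 3)))
    (hopen : ¬ N.IsOpenTriple W (v t) (v (t + 1)) (v (t + 3))) :
    ∃ j, N.LeftDiscriminated v j (t + 1) := by
  have hp := h.path.triple t (by omega)
  have hp1 := h.path.triple (t + 1) (by omega)
  have hncol : ¬ N.IsCollider (v t) (v (t + 1)) (v (t + 3)) := by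
    intro hc
    have : ¬ ∃ z ∈ W, N.Ancestor (v (t + 1)) z := fun h' =>
      hopen ⟨fun _ => h', fun h => absurd hc h⟩
    have hd : N.Directed (v (t + 1)) (v (t + 2)) :=
      hN.directed_of_not_arrow (h.path.adj _ (by omega)) fun h' => this (hp.1 ⟨hc.1, h'⟩)
    obtain ⟨z, hz, hz'⟩ := hp1.1
      ⟨hd.2, hN.arrow_of_directed hc.2 hd (h.path.adj (t + 2) (by omega)).symm⟩
    exact this ⟨z, hz, .head hd hz'⟩
  have hcol : N.IsCollider (v t) (v (t + 1)) (v (t + 2)) := by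
    by_contra hc
    exact hopen ⟨fun h => absurd h hncol, fun _ => hp.2 hc⟩
  have hd : N.Directed (v (t + 1)) (v (t + 3)) :=
    hN.directed_of_not_arrow hadj fun h => hncol ⟨hcol.1, h⟩
  obtain ⟨j, hj, hj0, hj1, hj2⟩ := h.path.scan hN t (by omega) hcol.1 hd
  rcases hj2 with hj2 | ⟨hj2, hj3⟩
  · refine ⟨j, by omega, hj2, fun k hk hkt => ?_⟩
    rcases (Nat.lt_succ_iff.1 hkt).lt_or_eq with h' | rfl
    · exact hj1 k hk h'
    · exact ⟨hd, hcol⟩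
  exfalso
  -- The edge from `v j` has an arrowhead at `v (t + 3)`. If the old edge from `v (t + 2)` lacked
  -- one while the new triple is a collider, then `v (t + 1) → v (t + 3) → v (t + 2)` would
  -- contradict the arrowhead at `v (t + 1)`.
  have hright : t + 4 ≤ n → N.IsOpenTriple W (v j) (v (t + 3)) (v (t + 4)) := by
    intro hn
    have hp2 := h.path.triple (t + 2) (by omega)
    refine ⟨fun hc => ?_, fun hc => hp2.2 fun hc' => hc ⟨hj2, hc'.2⟩⟩
    refine hp2.1 ⟨?_, hc.2⟩
    by_contra ha
    have hd' := hN.directed_of_not_arrow (h.path.adj (t + 2) (by omega)).symm ha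
    exact hN.not_arrow_of_transGen ((Relation.TransGen.single hd).tail hd') hcol.2
  have hle := h.le _ _ ((h.path.take (m := j) (by omega)).concat
    (h.path.shift (k := t + 3) (by omega)) (fun a b ha hb hab => ?_) (adj_of_mark hj2) hj3
    (fun hn => hright (by omega))) (concat_le (by omega)) ?_
  · omega
  · have := h.path.inj _ _ (by omega) (by omega) hab
    omega
  · rw [concat_add]
    exact congrArg v (by omega)

/-- Each triple of a shortest m-connecting path is the end of a discriminating sequence that runs
along the path. -/
lemma IsShortest.discriminated {N : MixedGraph V} (hN : N.IsMAG) {W : Finset V} {n : ℕ}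
    {v : ℕ → V} (h : N.IsShortest W n v) {t : ℕ} (ht : t + 2 ≤ n) :
    (∃ j, N.LeftDiscriminated v j t) ∨ ∃ j, N.RightDiscriminated v j t ∧ j ≤ n := by
  by_cases hadj : N.Adj (v t) (v (t + 2))
  swap
  · exact Or.inl ⟨t, le_rfl, hadj, fun k _ _ => absurd (‹t ≤ k›) (by omega)⟩
  by_cases hl : ∀ s, s + 1 = t → N.IsOpenTriple W (v s) (v t) (v (t + 2))
  swap
  · push Not at hl
    obtain ⟨s, rfl, hs⟩ := hl
    exact Or.inl (h.leftDiscriminated hN (by omega) hadj hs)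
  by_cases hr : t + 3 ≤ n → N.IsOpenTriple W (v t) (v (t + 2)) (v (t + 3))
  swap
  · push Not at hr
    obtain ⟨hn, hr⟩ := hr
    have hi : n - (t + 2) = n - (t + 3) + 1 := by omega
    obtain ⟨j, hj⟩ := h.reverse.leftDiscriminated hN (t := n - (t + 3)) (by omega)
      (by simpa only [show n - (n - (t + 3) + 1) = t + 2 by omega,
          show n - (n - (t + 3) + 3) = t by omega] using hadj.symm)
      (by
        simp only [show n - (n - (t + 3) + 1) = t + 2 by omega,
          show n - (n - (t + 3) + 3) = t by omega, show n - (n - (t + 3)) = t + 3 by omega]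
        exact fun h' => hr h'.symm)
    rw [← hi] at hj
    exact Or.inr ⟨_, rightDiscriminated_of_reverse ht hj, Nat.sub_le _ _⟩
  exfalso
  have hle := h.le _ _ ((h.path.take (m := t) (by omega)).concat
    (h.path.shift (k := t + 2) (by omega)) (fun a b ha hb hab => ?_) hadj hl
    (fun hn => hr (by omega))) (concat_le (by omega)) ?_
  · omega
  · have := h.path.inj _ _ (by omega) (by omega) hab
    omega
  · rw [concat_add]
    exact congrArg v (by omega)

/-- Two triples of a path do not lie on each other's discriminating sequences. -/
lemma IsTriplePath.not_cross {N : MixedGraph V} (hN : N.IsMAG) {R : V → V → V → Prop} {n : ℕ}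
    {v : ℕ → V} (hv : N.IsTriplePath R n v) {i j s t : ℕ} (ht : t + 2 ≤ n)
    (hl : N.LeftDiscriminated v j t) (hr : N.RightDiscriminated v i s) (hjs : j ≤ s) (hst : s < t)
    (hti : t + 2 ≤ i) : False := by
  obtain ⟨-, hl1, hl2⟩ := hl
  obtain ⟨-, hr1, hr2⟩ := hr
  have hleft : j < s → N.Directed (v s) (v (t + 2)) := fun h => by
    have := (hl2 (s - 1) (by omega) (by omega)).1
    rwa [show s - 1 + 1 = s by omega] at this
  -- A longer right sequence gives `v (t + 2) → v s`: a directed cycle if `j < s`, a forbidden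
  -- adjacency if `j = s`.
  have hi : i = t + 2 := by
    by_contra hne
    have hd := (hr2 (t + 1) (by omega) (by omega)).1
    rcases hjs.lt_or_eq with h | rfl
    · exact hN.no_directed_cycle _ ((Relation.TransGen.single hd).tail (hleft h))
    · exact hl1 hd.adj.symm
  subst hi
  have hj : j = s := by
    by_contra hne
    exact hr1 (hleft (by omega)).adj.symm
  subst hj
  have hne : v j ≠ v (t + 2) := fun h => by
    have := hv.inj _ _ (by omega) ht h
    omega
  -- Both sequences now span exactly `v j, …, v (t + 2)`, and together they make this an inducing
  -- path between non-adjacent nodes.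
  have hp : N.IsTriplePath (fun a b c => N.IsCollider a b c ∧
      (N.Ancestor b (v j) ∨ N.Ancestor b (v (t + 2)))) (t + 2 - j) (fun k => v (j + k)) := by
    have := (hv.take ht).shift (k := j) (by omega)
    refine ⟨this.adj, this.inj, fun k hk => ?_⟩
    by_cases hkt : j + k < t
    · have := hl2 (j + k) (by omega) hkt
      exact ⟨this.2, Or.inr (.single this.1)⟩
    · have := hr2 (j + k) (by omega) (by omega)
      exact ⟨this.2, Or.inl (.single this.1)⟩
  have := hp.exists_list
  simp only [Nat.add_zero, show j + (t + 2 - j) = t + 2 by omega] at this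
  exact hN.maximal _ _ hne hl1 this

/-- An induction principle along two families of intervals that do not cross. -/
lemma forall_of_not_cross {n : ℕ} {L R : ℕ → ℕ → Prop} {Q : ℕ → Prop}
    (h : ∀ t, t < n → (∃ j, L j t) ∨ ∃ j, R j t ∧ j ≤ n + 1)
    (hL : ∀ j t, t < n → L j t → (∀ k, j ≤ k → k < t → Q k) → Q t)
    (hR : ∀ j t, t < n → j ≤ n + 1 → R j t → (∀ k, t < k → k + 2 ≤ j → Q k) → Q t)
    (hcross : ∀ i j s t, t < n → L j t → R i s → j ≤ s → s < t → t + 2 ≤ i → False) :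
    ∀ t, t < n → Q t := by
  classical
  by_contra hcon
  have hRbad : ∃ s, s < n ∧ ¬ Q s ∧ ∃ j, R j s ∧ j ≤ n + 1 := by
    by_contra hno
    push Not at hno
    refine hcon fun t => ?_
    induction t using Nat.strong_induction_on with
    | _ t ih =>
      intro ht
      by_contra hQ
      rcases h t ht with ⟨j, hj⟩ | ⟨j, hj, hj'⟩
      · exact hQ (hL j t ht hj fun k _ hk => ih k hk (by omega))
      · exact absurd (hno t ht hQ j hj) (by omega)
  -- Take the last failing `s` with a right interval and the first failure `t` inside that interval.
  -- Then `t` has a left interval, whose own failure must lie at or before `s`: the two intervals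
  -- cross.
  obtain ⟨s, ⟨hs, hQs, i, hi, hin⟩, hmax⟩ : ∃ s, (s < n ∧ ¬ Q s ∧ ∃ j, R j s ∧ j ≤ n + 1) ∧
      ∀ s', s < s' → ¬ (s' < n ∧ ¬ Q s' ∧ ∃ j, R j s' ∧ j ≤ n + 1) := by
    obtain ⟨s, hs⟩ := hRbad
    refine ⟨_, Nat.findGreatest_spec (P := fun s => s < n ∧ ¬ Q s ∧ ∃ j, R j s ∧ j ≤ n + 1)
      hs.1.le hs, fun s' hs' h' => Nat.findGreatest_is_greatest hs' h'.1.le h'⟩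
  have hex : ∃ t, s < t ∧ t + 2 ≤ i ∧ ¬ Q t := by
    by_contra hno
    push Not at hno
    exact hQs (hR i s hs hin hi hno)
  obtain ⟨hst, hti, hQt⟩ := Nat.find_spec hex
  have hmin := fun k => Nat.find_min hex (m := k)
  set t := Nat.find hex
  have htn : t < n := by omega
  rcases h t htn with ⟨j, hj⟩ | hj
  · refine hQt (hL j t htn hj fun k hk hkt => ?_)
    by_contra hQk
    have hks : k ≤ s := by
      by_contra hks
      exact hmin k hkt ⟨by omega, by omega, hQk⟩
    exact hcross i j s t htn hj hi (hk.trans hks) hst hti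
  · exact hmax t hst ⟨htn, hQt, hj⟩

lemma IsTriplePath.isDiscriminating {N : MixedGraph V} {R : V → V → V → Prop} {n : ℕ} {v : ℕ → V}
    (hv : N.IsTriplePath R n v) {j t : ℕ} {y : V} (ht : t + 1 ≤ n) (hjt : j ≤ t) (hne : v j ≠ y)
    (hadj : N.Adj (v (t + 1)) y) (hnadj : ¬ N.Adj (v j) y)
    (h : ∀ k, j ≤ k → k < t → N.Directed (v (k + 1)) y ∧ N.IsCollider (v k) (v (k + 1)) (v (k + 2))) :
    N.IsDiscriminating (t - j + 1) (fun s => v (j + s)) y := by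
  have hp := (hv.take ht).shift (k := j) (by omega)
  rw [show t + 1 - j = t - j + 1 by omega] at hp
  refine ⟨by omega, ⟨hp.adj, hp.inj, fun k hk => ?_⟩, ?_, hne, hnadj⟩
  · exact (h (j + k) (by omega) (by omega)).symm
  · simpa only [show j + (t - j + 1) = t + 1 by omega] using hadj

/-- The end of a discriminating sequence along a path is settled if its inner triples are. -/
lemma IsPAGOf.isSettled_of_isTriplePath [Fintype V] {P N : MixedGraph V} (hP : P.IsPAGOf N)
    (hN : N.IsMAG) {R : V → V → V → Prop} {n : ℕ} {v : ℕ → V} (hv : N.IsTriplePath R n v)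
    {j t : ℕ} {y : V} (ht : t + 1 ≤ n) (hjt : j ≤ t) (hne : v j ≠ y)
    (hadj : N.Adj (v (t + 1)) y) (hnadj : ¬ N.Adj (v j) y)
    (h : ∀ k, j ≤ k → k < t → N.Directed (v (k + 1)) y ∧ N.IsCollider (v k) (v (k + 1)) (v (k + 2)))
    (hs : ∀ k, j ≤ k → k < t → IsSettled P N (v k) (v (k + 1)) (v (k + 2))) :
    IsSettled P N (v t) (v (t + 1)) y := by
  have := hP.isSettled_of_isDiscriminating hN (hv.isDiscriminating ht hjt hne hadj hnadj h)
    fun k hk => hs (j + k) (by omega) (by omega)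
  simpa only [show j + (t - j + 1) = t + 1 by omega, show j + (t - j) = t by omega] using this

/-- All triples of a shortest m-connecting path are settled. -/
lemma IsPAGOf.isSettled [Fintype V] {P N : MixedGraph V} (hP : P.IsPAGOf N)
    (hN : N.IsMAG) {W : Finset V} {n : ℕ} {v : ℕ → V} (h : N.IsShortest W n v) :
    ∀ t, t + 2 ≤ n → IsSettled P N (v t) (v (t + 1)) (v (t + 2)) := by
  intro t ht
  -- A path with `n ≥ 2` edges has `n - 1` triples, so the bound `n + 1` of the principle becomes
  -- the last index `n`.
  refine forall_of_not_cross (n := n - 1) (L := N.LeftDiscriminated v)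
    (R := N.RightDiscriminated v) (Q := fun t => IsSettled P N (v t) (v (t + 1)) (v (t + 2)))
    (fun t ht => ?_) (fun j t ht hl hs => ?_) (fun j t ht hj hr hs => ?_)
    (fun i j s t ht hl hr => h.path.not_cross hN (by omega) hl hr) t (by omega)
  · rw [show n - 1 + 1 = n by omega]
    exact h.discriminated hN (by omega)
  · refine hP.isSettled_of_isTriplePath hN h.path (by omega) hl.1 (fun h' => ?_)
      (h.path.adj _ (by omega)) hl.2.1 hl.2.2 hs
    have h1 := hl.1
    have := h.path.inj _ _ (by omega) (by omega) h'
    omega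
  · obtain ⟨h1, h2, h3⟩ := hr
    have hi : n - (n - (t + 2)) = t + 2 := by omega
    have hi' : n - (n - (t + 2) + 1) = t + 1 := by omega
    have hij : n - (n - j) = j := by omega
    have := hP.isSettled_of_isTriplePath hN h.path.reverse_open (j := n - j) (t := n - (t + 2))
      (y := v t) (by omega) (by omega) ?_ ?_ ?_ ?_ ?_
    · rw [hi, hi'] at this
      exact this.symm
    · intro h'
      have := h.path.inj _ _ (by omega) (by omega) h'
      omega
    · rw [hi']
      exact (h.path.adj t (by omega)).symm
    · rwa [hij]
    · intro k hk hkt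
      have := h3 (n - (k + 2)) (by omega) (by omega)
      rw [show n - (k + 2) + 1 = n - (k + 1) by omega, show n - (k + 2) + 2 = n - k by omega] at this
      exact ⟨this.1, this.2.symm⟩
    · intro k hk hkt
      have := hs (n - (k + 2)) (by omega) (by omega)
      rw [show n - (k + 2) + 1 = n - (k + 1) by omega, show n - (k + 2) + 2 = n - k by omega] at this
      exact this.symm

/-! ### Directed paths to the conditioning set -/

/-- There is a directed walk with `n` edges from `a` to `W`. -/
def Reaches (N : MixedGraph V) (W : Finset V) : ℕ → V → Prop
  | 0, a => a ∈ W
  | n + 1, a => ∃ b, N.Directed a b ∧ Reaches N W n b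

/-- The length of a shortest directed path from `a` to `W`. -/
noncomputable def distTo (N : MixedGraph V) (W : Finset V) (a : V) : ℕ :=
  sInf {n | N.Reaches W n a}

lemma Reaches.ancestor {N : MixedGraph V} {W : Finset V} :
    ∀ {n : ℕ} {a : V}, N.Reaches W n a → ∃ z ∈ W, N.Ancestor a z
  | 0, a, h => ⟨a, h, .refl⟩
  | n + 1, a, ⟨b, hab, hb⟩ => by
    obtain ⟨z, hz, h⟩ := Reaches.ancestor hb
    exact ⟨z, hz, .head hab h⟩

lemma exists_reaches {N : MixedGraph V} {W : Finset V} {a z : V} (hz : z ∈ W)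
    (h : N.Ancestor a z) : ∃ n, N.Reaches W n a := by
  induction h using Relation.ReflTransGen.head_induction_on with
  | refl => exact ⟨0, hz⟩
  | head hab _ ih =>
    obtain ⟨n, hn⟩ := ih
    exact ⟨n + 1, _, hab, hn⟩

lemma Reaches.distTo_le {N : MixedGraph V} {W : Finset V} {n : ℕ} {a : V}
    (h : N.Reaches W n a) : N.distTo W a ≤ n := Nat.sInf_le h

lemma reaches_distTo {N : MixedGraph V} {W : Finset V} {a : V}
    (h : ∃ z ∈ W, N.Ancestor a z) : N.Reaches W (N.distTo W a) a := by
  obtain ⟨z, hz, h⟩ := h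
  exact Nat.sInf_mem (s := {n | N.Reaches W n a}) (exists_reaches hz h)

/-- A shortest directed path to `W` is directed in the PAG as soon as its first edge is. -/
lemma IsPAGOf.ancestor_of_directed [Fintype V] {P N : MixedGraph V} (hP : P.IsPAGOf N)
    (hN : N.IsMAG) {W : Finset V} : ∀ {n : ℕ} {a b : V}, P.Directed a b → N.Reaches W n b →
      N.distTo W a = n + 1 → ∃ z ∈ W, P.Ancestor a z
  | 0, a, b, hab, hb, _ => ⟨b, hb, .single hab⟩
  | n + 1, a, b, hab, ⟨d, hbd, hd⟩, ha => by
    have hab' := hP.directed hN (markovEquiv_refl N) hab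
    -- An edge between `a` and `d` would shorten the directed path. So the triple is unshielded, and
    -- `P` carries the orientation one edge further.
    have hnadj : ¬ N.Adj a d := fun h => by
      have : N.Reaches W (n + 1) a := ⟨d, hN.directed_trans hab' hbd h, hd⟩
      have := this.distTo_le
      omega
    have hne : a ≠ d := by
      rintro rfl
      exact hN.no_directed_cycle a ((Relation.TransGen.single hab').tail hbd)
    have hbd' : P.Directed b d :=
      ((hP.isUnshielded hN ⟨hab'.adj, hbd.adj, hne, hnadj⟩).2 fun h =>
        hbd.not_arrow h.2).directed hab.2
    have hb : N.distTo W b = n + 1 := by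
      have h1 : N.Reaches W (n + 1) b := ⟨d, hbd, hd⟩
      have h2 : N.Reaches W (N.distTo W b + 1) a := ⟨b, hab', reaches_distTo h1.ancestor⟩
      have := h1.distTo_le
      have := h2.distTo_le
      omega
    obtain ⟨z, hz, h⟩ := hP.ancestor_of_directed hN hbd' hd hb
    exact ⟨z, hz, .head hab h⟩

/-! ### Shortest m-connecting paths close to the conditioning set -/

/-- A shortest m-connecting path whose nodes have the least total distance to `W`. -/
structure IsClosest (N : MixedGraph V) (W : Finset V) (n : ℕ) (v : ℕ → V) : Prop
    extends N.IsShortest W n v where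
  sum_le : ∀ v', N.IsTriplePath (N.IsOpenTriple W) n v' → v' 0 = v 0 → v' n = v n →
    ∑ s ∈ Finset.range (n + 1), N.distTo W (v s) ≤ ∑ s ∈ Finset.range (n + 1), N.distTo W (v' s)

/-- The length is minimised first, then the total distance among paths of that length. -/
lemma IsTriplePath.exists_isClosest {N : MixedGraph V} {W : Finset V} {n : ℕ} {v : ℕ → V}
    (h : N.IsTriplePath (N.IsOpenTriple W) n v) :
    ∃ n' v', N.IsClosest W n' v' ∧ v' 0 = v 0 ∧ v' n' = v n := by
  classical
  have h1 : ∃ n' v', N.IsTriplePath (N.IsOpenTriple W) n' v' ∧ v' 0 = v 0 ∧ v' n' = v n :=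
    ⟨n, v, h, rfl, rfl⟩
  have h2 : ∃ k v', N.IsTriplePath (N.IsOpenTriple W) (Nat.find h1) v' ∧ v' 0 = v 0 ∧
      v' (Nat.find h1) = v n ∧ ∑ s ∈ Finset.range (Nat.find h1 + 1), N.distTo W (v' s) = k := by
    obtain ⟨v', hv', h0, hn⟩ := Nat.find_spec h1
    exact ⟨_, v', hv', h0, hn, rfl⟩
  obtain ⟨v', hv', h0, hn, hk⟩ := Nat.find_spec h2
  refine ⟨_, v', ⟨⟨hv', fun n'' v'' hv'' h0' hn' => ?_⟩, fun v'' hv'' h0' hn' => ?_⟩, h0, hn⟩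
  · exact Nat.find_min' h1 ⟨v'', hv'', h0'.trans h0, hn'.trans hn⟩
  · rw [hk]
    exact Nat.find_min' h2 ⟨v'', hv'', h0'.trans h0, hn'.trans hn, rfl⟩

lemma IsOpenTriple.of_arrow {N : MixedGraph V} {W : Finset V} {a b c d : V}
    (h : N.IsOpenTriple W a b c) (hd : N.mark d b = some EndMark.arrow)
    (hb : ∃ z ∈ W, N.Ancestor b z) : N.IsOpenTriple W a b d :=
  ⟨fun _ => hb, fun h' => h.2 fun hc => h' ⟨hc.1, hd⟩⟩

/-- A closest m-connecting path cannot be continued from both sides to a node that is closer to `W`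
than the nodes in between. -/
lemma IsClosest.not_detour {N : MixedGraph V} {W : Finset V} {n : ℕ} {v : ℕ → V}
    (h : N.IsClosest W n v) {t j k : ℕ} {d : V} (hjt : j ≤ t) (htk : t + 2 ≤ k) (hk : k ≤ n)
    (hd : ∃ z ∈ W, N.Ancestor d z) (hdist : N.distTo W d < N.distTo W (v (t + 1)))
    (hj : N.mark (v j) d = some EndMark.arrow) (hj' : ∀ s, s + 1 = j → N.IsOpenTriple W (v s) (v j) d)
    (hk1 : N.mark (v k) d = some EndMark.arrow)
    (hk2 : k + 1 ≤ n → N.IsOpenTriple W d (v k) (v (k + 1))) : False := by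
  have hp := h.path
  have hend : ∀ {m i : ℕ} {u : ℕ → V}, i ≤ n → concat m u (fun s => v (i + s)) (m + 1 + (n - i)) =
      v n := fun hi => by
    rw [concat_add]
    exact congrArg v (by omega)
  -- If `d` already lies on one of the two retained pieces, joining that piece at `d` directly to
  -- the other gives a shorter path.
  by_cases h1 : ∃ i, i ≤ j ∧ v i = d
  · obtain ⟨i, hi, rfl⟩ := h1
    have hle := h.le _ _ ((hp.take (m := i) (by omega)).concat (hp.shift (k := k) hk)
      (fun a b ha hb hab => ?_) (adj_of_mark hk1).symm (fun s hs => ?_) (fun _ => hk2 (by omega)))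
      (concat_le (by omega)) (hend hk)
    · omega
    · have := hp.inj _ _ (by omega) (by omega) hab
      omega
    · subst hs
      exact (hp.triple s (by omega)).of_arrow hk1 hd
  by_cases h2 : ∃ i, k ≤ i ∧ i ≤ n ∧ v i = d
  · obtain ⟨i, hi, hin, rfl⟩ := h2
    have hki : k ≠ i := by
      rintro rfl
      exact (adj_of_mark hk1).ne rfl
    have hle := h.le _ _ ((hp.take (m := j) (by omega)).concat (hp.shift (k := i) hin)
      (fun a b ha hb hab => ?_) (adj_of_mark hj) hj' (fun hi' => ?_))
      (concat_le (by omega)) (hend hin)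
    · omega
    · have := hp.inj _ _ (by omega) (by omega) hab
      omega
    · have := hp.triple (i - 1) (by omega)
      rw [show i - 1 + 1 = i by omega, show i - 1 + 2 = i + 1 by omega] at this
      exact (this.symm.of_arrow hj hd).symm
  push Not at h1 h2
  have hu := (hp.take (m := j) (by omega)).snoc (y := d) h1 (adj_of_mark hj) hj'
  have hu1 : concat j v (fun _ => d) (j + 1) = d := concat_add (t := 0)
  have hw := hu.concat (hp.shift (k := k) hk) (fun a b ha hb => ?_)
    (by rw [hu1]; exact (adj_of_mark hk1).symm) (fun s hs => ?_)
    (fun _ => by rw [hu1]; exact hk2 (by omega))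
  rotate_left
  · rcases ha.lt_or_eq with ha | rfl
    · rw [concat_le (by omega)]
      intro hab
      have := hp.inj _ _ (by omega) (by omega) hab
      omega
    · rw [hu1]
      exact (h2 _ (by omega) (by omega)).symm
  · obtain rfl : s = j := by omega
    rw [hu1, concat_le le_rfl]
    exact ⟨fun _ => hd, fun h' => absurd ⟨hj, hk1⟩ h'⟩
  have hw0 : concat (j + 1) (concat j v fun _ => d) (fun s => v (k + s)) 0 = v 0 := by
    rw [concat_le (by omega), concat_le (by omega)]
  have hle := h.le _ _ hw hw0 (hend hk)
  -- The detour through `d` cannot be shorter, so it merely replaces `v (t + 1)` by `d`, which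
  -- lowers the total distance.
  obtain rfl : j = t := by omega
  obtain rfl : k = j + 2 := by omega
  have hn : j + 1 + 1 + (n - (j + 2)) = n := by omega
  have hwn := hend (m := j + 1) (u := concat j v fun _ => d) hk
  rw [hn] at hw hwn
  have hsum := h.sum_le _ hw hw0 hwn
  have heq : ∀ s, s ≠ j + 1 →
      concat (j + 1) (concat j v fun _ => d) (fun s => v (j + 2 + s)) s = v s := by
    intro s hs
    rcases le_or_gt s j with h' | h'
    · rw [concat_le (by omega), concat_le h']
    · obtain ⟨i, rfl⟩ : ∃ i, s = j + 1 + 1 + i := ⟨s - (j + 2), by omega⟩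
      rw [concat_add]
  refine absurd hsum (not_le.2 (Finset.sum_lt_sum (fun s _ => ?_)
    ⟨j + 1, Finset.mem_range.2 (by omega), ?_⟩))
  · rcases eq_or_ne s (j + 1) with rfl | hs
    · rw [concat_le le_rfl, hu1]
      exact hdist.le
    · rw [heq s hs]
  · rw [concat_le le_rfl, hu1]
    exact hdist

/-- A directed edge of the MAG out of a collider of the path is directed in the PAG, unless the path
can be continued to its head. -/
lemma IsPAGOf.directed_or_continued [Fintype V] {P N : MixedGraph V} (hP : P.IsPAGOf N)
    (hN : N.IsMAG) {W : Finset V} {n : ℕ} {v : ℕ → V}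
    (hv : N.IsTriplePath (N.IsOpenTriple W) n v)
    (hs : ∀ t, t + 2 ≤ n → IsSettled P N (v t) (v (t + 1)) (v (t + 2))) {t : ℕ} {d : V}
    (ht : t + 2 ≤ n) (hcol : N.IsCollider (v t) (v (t + 1)) (v (t + 2)))
    (hd : N.Directed (v (t + 1)) d) :
    P.Directed (v (t + 1)) d ∨ ∃ j, j ≤ t ∧ N.mark (v j) d = some EndMark.arrow ∧
      ∀ s, s + 1 = j → N.IsOpenTriple W (v s) (v j) d := by
  obtain ⟨j, hj, hne, hj1, hj2⟩ := hv.scan hN t (by omega) hcol.1 hd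
  rcases hj2 with hj2 | hj2
  · have := hP.isSettled_of_isTriplePath hN hv (by omega) hj hne hd.adj hj2 hj1
      (fun k _ hk => hs k (by omega))
    exact Or.inl ((this.2 fun h => hd.not_arrow h.2).1.directed
      ((hs t ht).1 hcol).1.1)
  · exact Or.inr ⟨j, hj, hj2⟩

/-- The colliders of a closest m-connecting path are ancestors of `W` in the PAG. -/
lemma IsPAGOf.exists_ancestor [Fintype V] {P N : MixedGraph V} (hP : P.IsPAGOf N)
    (hN : N.IsMAG) {W : Finset V} {n : ℕ} {v : ℕ → V} (h : N.IsClosest W n v) {t : ℕ}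
    (ht : t + 2 ≤ n) (hcol : N.IsCollider (v t) (v (t + 1)) (v (t + 2))) :
    ∃ z ∈ W, P.Ancestor (v (t + 1)) z := by
  have hs := hP.isSettled hN h.toIsShortest
  have hr := reaches_distTo ((h.path.triple t ht).1 hcol)
  rcases hm : N.distTo W (v (t + 1)) with _ | m
  · rw [hm] at hr
    exact ⟨_, hr, .refl⟩
  rw [hm] at hr
  obtain ⟨d, hbd, hd⟩ := hr
  refine hP.ancestor_of_directed hN (b := d) ?_ hd hm
  rcases hP.directed_or_continued hN h.path hs ht hcol hbd with h1 | ⟨j, hj, hj1, hj2⟩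
  · exact h1
  have hi : n - (n - (t + 2)) = t + 2 := by omega
  have hi1 : n - (n - (t + 2) + 1) = t + 1 := by omega
  have hi2 : n - (n - (t + 2) + 2) = t := by omega
  have hr := hP.directed_or_continued hN (t := n - (t + 2)) (d := d) h.path.reverse_open
    (fun s hs' => ?_) (by omega) (by rw [hi, hi1, hi2]; exact hcol.symm) (by rwa [hi1])
  · rw [hi1] at hr
    rcases hr with h1 | ⟨k, hk, hk1, hk2⟩
    · exact h1
    · refine (h.not_detour hj (k := n - k) (by omega) (by omega) hd.ancestor ?_ hj1 hj2 hk1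
        fun hk' => ?_).elim
      · have := hd.distTo_le
        omega
      · have := hk2 (k - 1) (by omega)
        rw [show n - (k - 1) = n - k + 1 by omega] at this
        exact this.symm
  · have := hs (n - (s + 2)) (by omega)
    rw [show n - (s + 2) + 1 = n - (s + 1) by omega, show n - (s + 2) + 2 = n - s by omega] at this
    exact this.symm

/-! ### Minimal separators -/

/-- A discriminating sequence corresponds to the pair of its endpoints. -/
lemma IsDiscriminating.tripleCorresponds {G : MixedGraph V} {m : ℕ} {u : ℕ → V} {y : V}
    (h : G.IsDiscriminating (m + 1) u y) : G.TripleCorresponds (u m) (u (m + 1)) y (u 0) y := by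
  refine ⟨h.ne, h.not_adj, ?_⟩
  rcases m with _ | m
  · exact Or.inl ⟨rfl, rfl, h.path.adj 0 one_pos, h.adj, h.ne, h.not_adj⟩
  refine Or.inr (Or.inl ⟨rfl, (List.range m).map fun t => u (t + 1), ?_⟩)
  have hw := (h.path.mono (R' := fun _ _ _ => True) fun _ _ _ => trivial).snoc
    (fun s hs => h.node_ne hs) h.adj fun _ _ => trivial
  have hlist : (List.range (m + 1 + 1 + 1 + 1)).map (concat (m + 1 + 1) u fun _ => y) =
      u 0 :: ((List.range m).map (fun t => u (t + 1)) ++ [u (m + 1), u (m + 1 + 1), y]) := by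
    have h1 : (List.range (m + 3)).map (concat (m + 1 + 1) u fun _ => y) =
        (List.range (m + 3)).map u := by
      refine List.map_congr_left fun t ht => concat_le ?_
      have := List.mem_range.1 ht
      omega
    rw [List.range_succ, List.map_append, h1,
      List.range_succ, List.range_succ, List.range_succ_eq_map]
    simp [MixedGraph.concat, Function.comp_def]
  have hpath := hw.isPath
  have hlast : concat (m + 1 + 1) u (fun _ => y) (m + 1 + 1 + 1) = y := concat_add (t := 0)
  rw [hlast, concat_le (by omega)] at hpath
  rw [IsDiscriminatingPath, ← hlist]
  refine ⟨hpath, h.not_adj, fun x hx => ?_⟩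
  obtain ⟨k, hk, rfl⟩ : ∃ k, k < m + 1 ∧ u (k + 1) = x := by
    simp only [List.mem_append, List.mem_map, List.mem_range, List.mem_singleton] at hx
    rcases hx with ⟨k, hk, rfl⟩ | rfl
    · exact ⟨k, by omega, rfl⟩
    · exact ⟨m, by omega, rfl⟩
  refine ⟨h.directed (by omega) (by omega), fun a c hac => ?_⟩
  obtain ⟨t, ht, rfl, hb, rfl⟩ := consecutive_map_range hac
  have hkt : k + 1 = t + 1 := by
    refine hw.inj _ _ (by omega) (by omega) ?_
    rw [← hb, concat_le (by omega)]
  obtain rfl : k = t := by omega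
  rw [concat_le (by omega), concat_le (by omega)]
  exact (h.path.triple k (by omega)).1

/-- The witnesses provided by a definite non-collider with order that ends a discriminating
sequence. -/
lemma IsPAGOf.exists_minSep_of_endsDiscriminating [Fintype V] {P N : MixedGraph V}
    (hP : P.IsPAGOf N) (hN : N.IsMAG) {a b c : V} (hd : P.IsDefNonCollider a b c)
    (ho : P.HasOrder false a b c) (he : P.EndsDiscriminating a b c) :
    ∃ (X' Y' : V) (Z' : Finset V), Z' ∈ P.MinSep X' Y' ∧ b ∈ Z' ∧
      ∃ A : V, P.NonColliderWithOrder A b Y' ∧ P.TripleCorresponds A b Y' X' Y' := by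
  obtain ⟨m, u, y, h, rfl, h'⟩ := he
  have hd' : P.IsDefNonCollider (u m) (u (m + 1)) y := by
    rcases h' with ⟨rfl, rfl⟩ | ⟨rfl, rfl⟩
    · exact hd
    · exact hd.symm
  have ho' : P.HasOrder false (u m) (u (m + 1)) y := by
    rcases h' with ⟨rfl, rfl⟩ | ⟨rfl, rfl⟩
    · exact ho
    · exact ho.symm
  obtain ⟨S, hS⟩ := hP.exists_minSep hN h.ne h.not_adj
  exact ⟨u 0, y, S, hS, h.mem_of_pagMSep hd' hS.2.2.2.2.1, u m, ho'.nonColliderWithOrder,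
    h.tripleCorresponds⟩

end MixedGraph

-- Locating the separator node on the connecting path

theorem proposition1 {V : Type*} [Fintype V] (r : ℕ) (P : MixedGraph V)
    (hP : MixedGraph.IsRPAG r P) (X Y : V) (Z : Finset V) (hZ : Z ∈ P.MinSep X Y)
    (Zi : V) (hZi : Zi ∈ Z) :
    ∃ (X' Y' : V) (Z' : Finset V), Z' ∈ P.MinSep X' Y' ∧ Zi ∈ Z' ∧
      ∃ A : V, P.NonColliderWithOrder A Zi Y' ∧ P.TripleCorresponds A Zi Y' X' Y' := by
  classical
  obtain ⟨-, -, N, hN, hPN, -, -⟩ := hP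
  obtain ⟨-, -, -, -, hsep, hmin⟩ := hZ
  have hconn := hmin _ (Finset.erase_ssubset hZi)
  rw [MixedGraph.pagMSep_iff] at hconn hsep
  push Not at hconn
  obtain ⟨n₀, v₀, hv₀, hX, hY, -⟩ := hconn
  obtain ⟨n, v, hv, h0, hn⟩ := (hPN.isTriplePath hN hv₀).exists_isClosest
  have hs := hPN.isSettled hN hv.toIsShortest
  -- If Zi were not a non-collider of the path, adding it to W would block nothing, and the path
  -- would connect given Z in `P`.
  have hex : ∃ t, t + 2 ≤ n ∧ ¬ N.IsCollider (v t) (v (t + 1)) (v (t + 2)) ∧ v (t + 1) = Zi := by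
    by_contra hno
    push Not at hno
    refine hsep n v ⟨fun t ht => (hPN.adj_iff hN _ _).2 (hv.path.adj t ht), hv.path.inj,
      fun t ht => ?_⟩ (h0.trans hX) (hn.trans hY)
    by_cases hc : N.IsCollider (v t) (v (t + 1)) (v (t + 2))
    · have hc' := ((hs t ht).1 hc).1
      obtain ⟨z, hz, hz'⟩ := hPN.exists_ancestor hN hv ht hc
      exact ⟨Or.inl hc', fun _ => ⟨z, Finset.mem_of_mem_erase hz, hz'⟩,
        fun h => absurd hc' h.not_isCollider⟩
    · have hd := ((hs t ht).2 hc).1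
      exact ⟨Or.inr hd, fun h => absurd h hd.not_isCollider, fun _ h =>
        (hv.path.triple t ht).2 hc (Finset.mem_erase.2 ⟨hno t ht hc, h⟩)⟩
  obtain ⟨t, ht, hc, rfl⟩ := hex
  obtain ⟨h1, h2, h3⟩ := (hs t ht).2 hc
  exact hPN.exists_minSep_of_endsDiscriminating hN h1 h2 h3
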